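/- **Itô's isometry for quadratic variation (model-free).** *Setting.* Let $\Omega\neq\emptyset$ carry a $\sigma$-field $\mathcal F$ and a filtration $(\mathcal F_t)_{t\ge 0}$, $\mathcal F_t\subseteq\mathcal F$, with $\mathcal F_0=\{\emptyset,\Omega\}$, and let $S^1,\dots,S^d$ ($d\ge 1$) be adapted real processes all of whose trajectories are continuous. A *process* is an adapted map $[0,\infty)\times\Omega\to[-\infty,\infty]$. A sequence of stopping times $(\tau_n)$ with values in $[0,\infty]$ is *proper* if it is non-decreasing, $\tau_0\equiv 0$, and for each $\omega$ it diverges to $\infty$ or is eventually constant. A *simple trading strategy* $G=(c,(\tau_n),(g_n))$ consists of $c\in\mathbb R$, a proper sequence $(\tau_n)$ and bounded $\mathcal F_{\tau_n}$-measurable $g_n:\Omega\to\mathbb R$ with $g_n=0$ on $\{\tau_n=\infty\}$; put $(G\cdot X)_t=c+\sum_{n\ge1}g_{n-1}(X_{\tau_n\wedge t}-X_{\tau_{n-1}\wedge t})$. A *simple capital process* is a process $\sum_{j=1}^d G^j\cdot S^j$. The class $\mathcal C$ of *nonnegative supermartingales* is the smallest class that contains all nonnegative simple capital processes, contains $X+Y$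 whenever $X\in\mathcal C$, $Y$ is a simple capital process and $X+Y\ge0$, and is closed under pointwise $\liminf$ of sequences. A set $E\subseteq[0,\infty)\times\Omega$ holds *with instant enforcement* (w.i.e.) if there is $U\in\mathcal C$ with $U_0=1$ and $U_t(\omega)=+\infty$ for all $(t,\omega)\notin E$; complements of such sets are *instantly blockable*. Assume that for every $t\ge0$ and every instantly blockable $B$ the projection of $B\cap([0,t]\times\Omega)$ onto $\Omega$ belongs to $\mathcal F_t$. For any $Y:[0,\infty)\times\Omega\to[-\infty,\infty]$ let $$\overline{\mathbb E}\,Y=\inf\{X_0: X\in\mathcal C,\ X_t(\omega)\ge Y_t(\omega)\text{ for all }(t,\omega)\}.$$ Processes $Y^m$ converge *locally uniformly w.i.e.* to $Y$ if $\{(t,\omega):\lim_m\sup_{s\in[0,t]}|Y^m_s(\omega)-Y_s(\omega)|=0\}$ holds w.i.e., and they do so *on $[0,\sigma]\setminus\{\infty\}$* if the same is true with $[0,\sigma(\omega)\wedge t]$ in place of $[0,t]$. The class of *martingales* is the smallest class of processes that are real w.i.e. which contains all simple capital processes and contains every process $X$, real w.i.e., that is the locally uniform limit w.i.e. of a sequence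 of its members. A *fine cover* of $X$ with accuracy $\delta>0$ w.i.e. is a non-decreasing sequence of stopping times $(\tau_n)$, $\tau_0\equiv0$, for which there is a set $E$ holding w.i.e. such that for every $(t,\omega)\in E$ only finitely many $n$ satisfy $\tau_n(\omega)\le t$, and $\sup_I X(\omega)-\inf_I X(\omega)\le\delta$ on each interval $I=[\tau_n(\omega)\wedge t,\tau_{n+1}(\omega)\wedge t]$. Let $[X]^{\tau}_t=\sum_{n\ge1}(X_{\tau_n\wedge t}-X_{\tau_{n-1}\wedge t})^2$. A *quadratic variation* $[X]$ of a martingale $X$ is a process, real and continuous w.i.e. (that is, w.i.e. in $(t,\omega)$ the trajectory $s\mapsto[X]_s(\omega)$ is real and continuous at $t$), such that for all $\delta_m>0$ with $\sum_{m}\delta_m<\infty$ and all fine covers $\sigma^m$ of $X$ with accuracy $\delta_m$ w.i.e., the processes $[X]^{\sigma^m}$ converge to $[X]$ locally uniformly w.i.e. on $[0,\sigma(X,M)]\setminus\{\infty\}$ for every $M\in(0,\infty)$, where $\sigma(X,M)=\inf\{t\ge 0:|X_t|\ge M\}$, and also locally uniformly w.i.e. *Statement.* Let $X$ be a martingale and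 $[X]$ its quadratic variation. Then $$\overline{\mathbb E}\,(X-X_0)^2=\overline{\mathbb E}\,[X].$$ -/

import Mathlib

open Filter Topology MeasureTheory
open scoped NNReal ENNReal

/-- A martingale space: a filtration `(ℱ_t)_{t ≥ 0}` on `Ω` whose initial σ-field is trivial, and
`d` basic continuous martingales `S^1, …, S^d`, that is adapted real processes all of whose
trajectories are continuous. No probability measure is involved. -/
structure MartingaleSpace (Ω : Type*) [mΩ : MeasurableSpace Ω] (d : ℕ) where
  /-- the filtration -/
  filt : Filtration ℝ≥0 mΩ
  /-- `ℱ_0 = {∅, Ω}` -/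
  filt_zero : filt 0 = ⊥
  /-- the basic martingales -/
  S : Fin d → ℝ≥0 → Ω → ℝ
  measurable_S : ∀ (j : Fin d) (t : ℝ≥0), Measurable[filt t] (S j t)
  continuous_S : ∀ (j : Fin d) (ω : Ω), Continuous fun t : ℝ≥0 => S j t ω

namespace MartingaleSpace

section Pathwise

variable {Ω : Type*}

/-- `sup_{s ∈ [0, T], s < ∞} |Y_s(ω) - Z_s(ω)|`, a number in `[0, ∞]`. The distance of an infinite
value to anything, including an infinite value, is `∞`. -/
noncomputable def uniformDist (Y Z : ℝ≥0 → Ω → EReal) (T : WithTop ℝ≥0) (ω : Ω) : ℝ≥0∞ :=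
  ⨆ (s : ℝ≥0) (_ : (s : WithTop ℝ≥0) ≤ T), (Y s ω - Z s ω).abs

/-- `σ(X, M) = inf {t ∈ [0, ∞) : |X_t| ≥ M}`, with `inf ∅ = ∞`. -/
noncomputable def exitTime (X : ℝ≥0 → Ω → EReal) (M : ℝ) (ω : Ω) : WithTop ℝ≥0 :=
  sInf {T : WithTop ℝ≥0 | ∃ t : ℝ≥0, T = t ∧ ENNReal.ofReal M ≤ (X t ω).abs}

/-- The simple quadratic variation
`[X]^τ_t = ∑_{n ≥ 1} (X_{τ_n ∧ t} - X_{τ_{n-1} ∧ t})^2`, a sum of terms in `[0, ∞]`. -/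
noncomputable def simpleQV (X : ℝ≥0 → Ω → EReal) (τ : ℕ → Ω → WithTop ℝ≥0)
    (t : ℝ≥0) (ω : Ω) : EReal :=
  ((∑' n : ℕ, (stoppedProcess X (τ (n + 1)) t ω - stoppedProcess X (τ n) t ω).abs ^ 2 : ℝ≥0∞) :
    EReal)

end Pathwise

variable {Ω : Type*} [MeasurableSpace Ω] {d : ℕ} (𝔐 : MartingaleSpace Ω d)

/-- A process with values in `[-∞, ∞]`: a mapping adapted to the filtration. -/
def IsAdapted (Y : ℝ≥0 → Ω → EReal) : Prop :=
  ∀ t : ℝ≥0, Measurable[𝔐.filt t] (Y t)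

/-- A proper sequence of stopping times: non-decreasing, starting from `0`, and for each `ω` either
divergent to `∞` or eventually constant. -/
structure IsProper (τ : ℕ → Ω → WithTop ℝ≥0) : Prop where
  isStoppingTime : ∀ n, IsStoppingTime 𝔐.filt (τ n)
  mono : ∀ n ω, τ n ω ≤ τ (n + 1) ω
  zero : ∀ ω, τ 0 ω = 0
  proper : ∀ ω, (∀ t : ℝ≥0, ∃ N, ∀ n ≥ N, (t : WithTop ℝ≥0) < τ n ω) ∨
    ∃ N, ∀ n ≥ N, τ n ω = τ N ω

/-- A simple trading strategy: an initial capital, a proper sequence of stopping times, and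
globally bounded positions `g_n`, measurable with respect to `ℱ_{τ_n}` and zero when
`τ_n = ∞`. -/
structure SimpleStrategy where
  /-- the initial capital -/
  c : ℝ
  /-- the trading times -/
  τ : ℕ → Ω → WithTop ℝ≥0
  isProper : 𝔐.IsProper τ
  /-- the positions -/
  g : ℕ → Ω → ℝ
  bounded_g : ∀ n, ∃ K : ℝ, ∀ ω, |g n ω| ≤ K
  measurable_g : ∀ n, Measurable[(isProper.isStoppingTime n).measurableSpace] (g n)
  g_eq_zero : ∀ n ω, τ n ω = ⊤ → g n ω = 0

variable {𝔐} in
/-- `(G · X)_t = c + ∑_{n ≥ 1} g_{n-1} (X_{τ_n ∧ t} - X_{τ_{n-1} ∧ t})`; only finitely many terms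
are non-zero because the trading times form a proper sequence. -/
noncomputable def SimpleStrategy.integral (G : 𝔐.SimpleStrategy) (X : ℝ≥0 → Ω → ℝ)
    (t : ℝ≥0) (ω : Ω) : ℝ :=
  G.c + ∑' n : ℕ, G.g n ω *
    (stoppedProcess X (G.τ (n + 1)) t ω - stoppedProcess X (G.τ n) t ω)

/-- A simple capital process `∑_j (G^j · S^j)`. -/
def IsSimpleCapital (V : ℝ≥0 → Ω → ℝ) : Prop :=
  ∃ G : Fin d → 𝔐.SimpleStrategy, ∀ t ω, V t ω = ∑ j, (G j).integral (𝔐.S j) t ω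

/-- The class `𝒞` of nonnegative supermartingales: the smallest class that contains the nonnegative
simple capital processes, is closed under adding a simple capital process as long as the sum is
nonnegative, and is closed under `liminf` of sequences. -/
inductive IsNonnegSupermartingale : (ℝ≥0 → Ω → EReal) → Prop
  | simple (V : ℝ≥0 → Ω → ℝ) (hV : 𝔐.IsSimpleCapital V) (h0 : ∀ t ω, 0 ≤ V t ω) :
      IsNonnegSupermartingale fun t ω => (V t ω : EReal)
  | add (X : ℝ≥0 → Ω → EReal) (V : ℝ≥0 → Ω → ℝ) (hX : IsNonnegSupermartingale X)
      (hV : 𝔐.IsSimpleCapital V) (h0 : ∀ t ω, 0 ≤ X t ω + (V t ω : EReal)) :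
      IsNonnegSupermartingale fun t ω => X t ω + (V t ω : EReal)
  | liminf (X : ℕ → ℝ≥0 → Ω → EReal) (hX : ∀ n, IsNonnegSupermartingale (X n)) :
      IsNonnegSupermartingale fun t ω => Filter.liminf (fun n => X n t ω) atTop

/-- A property `E ⊆ [0, ∞) × Ω` holds with instant enforcement (w.i.e.): some nonnegative
supermartingale starting from `1` is infinite wherever `E` fails. -/
def Enforceable (E : Set (ℝ≥0 × Ω)) : Prop :=
  ∃ U : ℝ≥0 → Ω → EReal, 𝔐.IsNonnegSupermartingale U ∧ (∀ ω, U 0 ω = 1) ∧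
    ∀ t ω, (t, ω) ∉ E → U t ω = ⊤

/-- Instantly blockable sets are the complements of the instantly enforceable ones. -/
def Blockable (B : Set (ℝ≥0 × Ω)) : Prop :=
  𝔐.Enforceable Bᶜ

/-- For each `t` and each instantly blockable `B`, the projection of `B ∩ ([0, t] × Ω)` onto `Ω`
belongs to `ℱ_t`. -/
def AssumptionA : Prop :=
  ∀ (t : ℝ≥0) (B : Set (ℝ≥0 × Ω)), 𝔐.Blockable B →
    MeasurableSet[𝔐.filt t] {ω | ∃ s : ℝ≥0, s ≤ t ∧ (s, ω) ∈ B}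

/-- The upper expectation of a generalized process `Y`: the infimum of the initial values of the
nonnegative supermartingales that dominate `Y` everywhere. -/
noncomputable def upperExp (Y : ℝ≥0 → Ω → EReal) : EReal :=
  sInf {x : EReal | ∃ X : ℝ≥0 → Ω → EReal, 𝔐.IsNonnegSupermartingale X ∧ (∀ ω, X 0 ω = x) ∧
    ∀ t ω, Y t ω ≤ X t ω}

/-- The process takes real values w.i.e. -/
def IsRealWIE (Y : ℝ≥0 → Ω → EReal) : Prop :=
  𝔐.Enforceable {p | Y p.1 p.2 ≠ ⊥ ∧ Y p.1 p.2 ≠ ⊤}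

/-- The trajectories are real and continuous w.i.e. -/
def IsContinuousWIE (Y : ℝ≥0 → Ω → EReal) : Prop :=
  𝔐.Enforceable {p | Y p.1 p.2 ≠ ⊥ ∧ Y p.1 p.2 ≠ ⊤ ∧ ContinuousAt (fun s => Y s p.2) p.1}

/-- Locally uniform convergence w.i.e. of `Y^m` to `Y` on the random interval `[0, σ] \ {∞}`. -/
def ConvergesLocUnifOn (σ : Ω → WithTop ℝ≥0) (Ym : ℕ → ℝ≥0 → Ω → EReal)
    (Y : ℝ≥0 → Ω → EReal) : Prop :=
  𝔐.Enforceable {p | Tendsto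
    (fun m => uniformDist (Ym m) Y (min (σ p.2) (p.1 : WithTop ℝ≥0)) p.2) atTop (𝓝 0)}

/-- Locally uniform convergence w.i.e. of `Y^m` to `Y`. -/
def ConvergesLocUnif (Ym : ℕ → ℝ≥0 → Ω → EReal) (Y : ℝ≥0 → Ω → EReal) : Prop :=
  𝔐.Enforceable {p | Tendsto
    (fun m => uniformDist (Ym m) Y (p.1 : WithTop ℝ≥0) p.2) atTop (𝓝 0)}

/-- The class `ℳ` of martingales: the smallest class of processes, real w.i.e., that contains the
simple capital processes and is closed under locally uniform convergence w.i.e. -/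
inductive IsMartingale : (ℝ≥0 → Ω → EReal) → Prop
  | simple (V : ℝ≥0 → Ω → ℝ) (hV : 𝔐.IsSimpleCapital V) :
      IsMartingale fun t ω => (V t ω : EReal)
  | lim (Xn : ℕ → ℝ≥0 → Ω → EReal) (X : ℝ≥0 → Ω → EReal) (hXn : ∀ n, IsMartingale (Xn n))
      (hX : 𝔐.IsAdapted X) (hreal : 𝔐.IsRealWIE X) (hlim : 𝔐.ConvergesLocUnif Xn X) :
      IsMartingale X

/-- `τ` is a fine cover of `X` with accuracy `δ` on the set `E`: a non-decreasing sequence of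
stopping times starting from `0` such that, for `(t, ω) ∈ E`, only finitely many `τ_n(ω)` are
`≤ t` and `X(ω)` oscillates by at most `δ` on each interval `[τ_n(ω) ∧ t, τ_{n+1}(ω) ∧ t]`. -/
structure IsFineCoverOn (X : ℝ≥0 → Ω → EReal) (δ : ℝ) (τ : ℕ → Ω → WithTop ℝ≥0)
    (E : Set (ℝ≥0 × Ω)) : Prop where
  isStoppingTime : ∀ n, IsStoppingTime 𝔐.filt (τ n)
  mono : ∀ n ω, τ n ω ≤ τ (n + 1) ω
  zero : ∀ ω, τ 0 ω = 0
  finite : ∀ t ω, (t, ω) ∈ E → {n : ℕ | τ n ω ≤ (t : WithTop ℝ≥0)}.Finite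
  osc : ∀ n t ω, (t, ω) ∈ E →
    sSup ((fun s => X s ω) '' {s : ℝ≥0 | min (τ n ω) t ≤ (s : WithTop ℝ≥0) ∧
        (s : WithTop ℝ≥0) ≤ min (τ (n + 1) ω) t}) -
      sInf ((fun s => X s ω) '' {s : ℝ≥0 | min (τ n ω) t ≤ (s : WithTop ℝ≥0) ∧
        (s : WithTop ℝ≥0) ≤ min (τ (n + 1) ω) t}) ≤ (δ : EReal)

/-- `τ` is a fine cover of `X` with accuracy `δ` w.i.e. -/
def IsFineCover (X : ℝ≥0 → Ω → EReal) (δ : ℝ) (τ : ℕ → Ω → WithTop ℝ≥0) : Prop :=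
  ∃ E : Set (ℝ≥0 × Ω), 𝔐.Enforceable E ∧ 𝔐.IsFineCoverOn X δ τ E

/-- `Q` is a quadratic variation `[X]` of `X`: a process, real and continuous w.i.e., such that, for
all fine covers `σ^m` of `X` w.i.e. with summable accuracies `δ_m > 0`, the simple quadratic
variations `[X]^{σ^m}` converge to `Q` locally uniformly w.i.e. on `[0, σ(X, M)] \ {∞}` for each
`M ∈ (0, ∞)`, and on all of `[0, ∞)`. The sequences `σ^m` need not be proper at those `ω` that are
exceptional for the fine cover: on such `ω` even the successive times at which `X` moves by a fixed
amount may accumulate. -/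
structure IsQuadraticVariation (X Q : ℝ≥0 → Ω → EReal) : Prop where
  isAdapted : 𝔐.IsAdapted Q
  continuous : 𝔐.IsContinuousWIE Q
  tendsto : ∀ (δ : ℕ → ℝ) (σ : ℕ → ℕ → Ω → WithTop ℝ≥0), (∀ m, 0 < δ m) → Summable δ →
    (∀ m, 𝔐.IsFineCover X (δ m) (σ m)) →
    (∀ M : ℝ, 0 < M → 𝔐.ConvergesLocUnifOn (exitTime X M) (fun m => simpleQV X (σ m)) Q) ∧
      𝔐.ConvergesLocUnif (fun m => simpleQV X (σ m)) Q

end MartingaleSpace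

/-! Let `τ_0 ≤ τ_1 ≤ …` be the successive times at which `X` has moved by `ε`. Summation by parts
gives `(X_t - X_0)² - [X]^τ_t = 2 ∑_l (X_{τ_l} - X_0)(X_{τ_{l+1} ∧ t} - X_{τ_l ∧ t})`
(`stepIntegral_displacement`). The right side is the gain from trading `X` with positions bounded by
multiples of `lε`. Hence a nonnegative supermartingale dominating one of `(X - X_0)²` and `[X]^τ`
can be turned into one dominating the other at arbitrarily small extra cost
(`IsMartingale.exists_dominating`). As `ε → 0` the processes `[X]^τ` tend to `[X]`, and a final
`liminf` replaces them by `[X]`.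

The obstacle is that `X` is not itself tradable: it is an iterated limit of simple capital
processes. `IsMartingale.exists_add_stepIntegral` goes by induction over the class of martingales.
For a simple capital process the gain is again a simple capital process, because trading times can
be inserted one by one (`JointIntegral.step`). For a limit of `X^n`, one trades `X^n` until the gain
deviates from that of `X` by a small constant, which is paid in cash in advance, and takes the
`liminf` over `n`.

All pathwise facts hold only off a blockable set, where a supermartingale of tiny initial capital is
infinite and dominates everything (`Enforceable.exists_small`). The stopping rules are legitimate
because `AssumptionA` makes `ℱ_t` complete with respect to trajectories that meet a blockable set by
time `t` (`IsRegular.isStoppingTime_hit`). -/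

namespace MartingaleSpace

/-! ### Truncated times -/

/-- The real time `t ∧ r`, for a possibly infinite `r`. -/
noncomputable def clock (t : ℝ≥0) (r : WithTop ℝ≥0) : ℝ≥0 := (min (t : WithTop ℝ≥0) r).untopA

lemma coe_clock (t : ℝ≥0) (r : WithTop ℝ≥0) :
    ((clock t r : ℝ≥0) : WithTop ℝ≥0) = min (t : WithTop ℝ≥0) r := by
  rcases r with _ | r
  · change ((clock t ⊤ : ℝ≥0) : WithTop ℝ≥0) = min (t : WithTop ℝ≥0) ⊤
    unfold clock
    rw [min_eq_left le_top]; rfl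
  · change ((clock t (r : WithTop ℝ≥0) : ℝ≥0) : WithTop ℝ≥0) = min (t : WithTop ℝ≥0) (r : WithTop ℝ≥0)
    unfold clock
    rw [← WithTop.coe_min]; rfl

lemma clock_eq_iff {t s : ℝ≥0} {r : WithTop ℝ≥0} :
    clock t r = s ↔ min (t : WithTop ℝ≥0) r = s := by
  rw [← coe_clock, WithTop.coe_inj]

lemma clock_of_le {t : ℝ≥0} {r : WithTop ℝ≥0} (h : (t : WithTop ℝ≥0) ≤ r) : clock t r = t := by
  rw [clock_eq_iff, min_eq_left h]

lemma coe_clock_of_ge {t : ℝ≥0} {r : WithTop ℝ≥0} (h : r ≤ t) :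
    ((clock t r : ℝ≥0) : WithTop ℝ≥0) = r := by
  rw [coe_clock, min_eq_right h]

lemma clock_le (t : ℝ≥0) (r : WithTop ℝ≥0) : clock t r ≤ t := by
  rw [← WithTop.coe_le_coe, coe_clock]; exact min_le_left _ _

lemma coe_clock_le (t : ℝ≥0) (r : WithTop ℝ≥0) : ((clock t r : ℝ≥0) : WithTop ℝ≥0) ≤ r := by
  rw [coe_clock]; exact min_le_right _ _

lemma clock_clock (t : ℝ≥0) (r s : WithTop ℝ≥0) : clock (clock t r) s = clock t (min r s) := by
  rw [clock_eq_iff, coe_clock, coe_clock, min_assoc]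

lemma clock_mono_right (t : ℝ≥0) {r r' : WithTop ℝ≥0} (h : r ≤ r') : clock t r ≤ clock t r' := by
  rw [← WithTop.coe_le_coe, coe_clock, coe_clock]
  exact min_le_min_left _ h

lemma clock_top (t : ℝ≥0) : clock t ⊤ = t := clock_of_le le_top

lemma clock_zero (t : ℝ≥0) : clock t 0 = 0 := by
  rw [clock_eq_iff, min_eq_right (zero_le)]; rfl

lemma zero_clock (r : WithTop ℝ≥0) : clock 0 r = 0 :=
  clock_of_le (by simp)

lemma clock_coe (t s : ℝ≥0) : clock t (s : WithTop ℝ≥0) = min t s := by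
  rw [clock_eq_iff, ← WithTop.coe_min]

lemma continuous_clock (r : WithTop ℝ≥0) : Continuous fun t => clock t r := by
  rcases r with _ | r
  · exact continuous_id.congr fun t => (clock_top t).symm
  · exact (continuous_id.min continuous_const).congr fun t => (clock_coe t r).symm

variable {Ω : Type*} {m : MeasurableSpace Ω} {d : ℕ} {𝔐 : MartingaleSpace Ω d}

/-- True by `rfl` because `clock` uses the same `untopA` of a minimum as `stoppedProcess`; the
minimum with a real `t` is never `⊤`, so no default value enters. -/
lemma stoppedProcess_apply {β : Type*} (u : ℝ≥0 → Ω → β) (τ : Ω → WithTop ℝ≥0) (t : ℝ≥0) (ω : Ω) :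
    stoppedProcess u τ t ω = u (clock t (τ ω)) ω := rfl

/-! ### Simple strategies through their increments -/

/-- On each interval `[σ_n, σ_{n+1}]` the process `V` moves like `g_n S`, and `V` is constant after
all the times `σ_n`. -/
structure Represents (S : ℝ≥0 → Ω → ℝ) (c : ℝ) (σ : ℕ → Ω → WithTop ℝ≥0) (g : ℕ → Ω → ℝ)
    (V : ℝ≥0 → Ω → ℝ) : Prop where
  start : ∀ ω, V 0 ω = c
  incr : ∀ n ω (s t : ℝ≥0), σ n ω ≤ s → s ≤ t → (t : WithTop ℝ≥0) ≤ σ (n + 1) ω →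
    V t ω - V s ω = g n ω * (S t ω - S s ω)
  const : ∀ ω (s t : ℝ≥0), s ≤ t → (∀ n, σ n ω ≤ s) → V t ω = V s ω

/-- `g` is a sequence of positions that can be held on the intervals between the times `σ_n`. -/
structure Admissible (𝔐 : MartingaleSpace Ω d) (σ : ℕ → Ω → WithTop ℝ≥0) (g : ℕ → Ω → ℝ) :
    Prop where
  bounded : ∀ n, ∃ K : ℝ, ∀ ω, |g n ω| ≤ K
  measurable : ∀ n (h : IsStoppingTime 𝔐.filt (σ n)), Measurable[h.measurableSpace] (g n)
  eq_zero : ∀ n ω, σ n ω = ⊤ → g n ω = 0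

lemma mono_of_le_succ {σ : ℕ → Ω → WithTop ℝ≥0} (h : ∀ n ω, σ n ω ≤ σ (n + 1) ω) (ω : Ω) :
    Monotone fun n => σ n ω := monotone_nat_of_le_succ fun n => h n ω

lemma integral_eq_sum (G : 𝔐.SimpleStrategy) (S : ℝ≥0 → Ω → ℝ) {t : ℝ≥0} {ω : Ω} {N : ℕ}
    (h : ∀ n ≥ N, clock t (G.τ n ω) = clock t (G.τ N ω)) :
    G.integral S t ω = G.c + ∑ n ∈ Finset.range N, G.g n ω *
      (S (clock t (G.τ (n + 1) ω)) ω - S (clock t (G.τ n ω)) ω) := by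
  unfold SimpleStrategy.integral
  simp only [stoppedProcess_apply]
  rw [tsum_eq_sum]
  intro n hn
  have hn' : N ≤ n := by simpa using hn
  rw [h n hn', h (n + 1) (by lia), sub_self, mul_zero]

lemma IsProper.exists_clock_eq {σ : ℕ → Ω → WithTop ℝ≥0} (hσ : 𝔐.IsProper σ) (t : ℝ≥0) (ω : Ω) :
    ∃ N, (∀ s ≤ t, ∀ n ≥ N, clock s (σ n ω) = clock s (σ N ω)) ∧
      ((t : WithTop ℝ≥0) < σ N ω ∨ ∀ n ≥ N, σ n ω = σ N ω) := by
  rcases hσ.proper ω with h | ⟨N, h⟩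
  · obtain ⟨N, hN⟩ := h t
    refine ⟨N, fun s hs n hn => ?_, Or.inl (hN N le_rfl)⟩
    have hs' : (s : WithTop ℝ≥0) ≤ t := WithTop.coe_le_coe.2 hs
    rw [clock_of_le (hs'.trans (hN n hn).le), clock_of_le (hs'.trans (hN N le_rfl).le)]
  · exact ⟨N, fun s _ n hn => by rw [h n hn], Or.inr h⟩

lemma represents_integral (G : 𝔐.SimpleStrategy) (S : ℝ≥0 → Ω → ℝ) :
    Represents S G.c G.τ G.g (G.integral S) where
  start ω := by
    rw [integral_eq_sum G S (N := 0) fun n _ => by rw [zero_clock, zero_clock]]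
    simp
  incr n ω s t hs hst ht := by
    have hmono := mono_of_le_succ G.isProper.mono ω
    have hs' : (s : WithTop ℝ≥0) ≤ t := WithTop.coe_le_coe.2 hst
    have key : ∀ r : ℝ≥0, (r : WithTop ℝ≥0) ≤ G.τ (n + 1) ω →
        ∀ k ≥ n + 1, clock r (G.τ k ω) = clock r (G.τ (n + 1) ω) := fun r hr k hk => by
      rw [clock_of_le hr, clock_of_le (hr.trans (hmono hk))]
    rw [integral_eq_sum G S (key t ht), integral_eq_sum G S (key s (hs'.trans ht)),
      add_sub_add_left_eq_sub, ← Finset.sum_sub_distrib, Finset.sum_range_succ,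
      Finset.sum_eq_zero]
    · have h1 : clock t (G.τ n ω) = clock s (G.τ n ω) := by
        rw [← WithTop.coe_inj, coe_clock_of_ge hs, coe_clock_of_ge (hs.trans hs')]
      rw [clock_of_le ht, clock_of_le (hs'.trans ht), h1]
      ring
    · intro i hi
      have hi' : i + 1 ≤ n := by simpa using hi
      have h1 : ∀ k ≤ n, clock t (G.τ k ω) = clock s (G.τ k ω) := fun k hk => by
        have := (hmono hk).trans hs
        rw [← WithTop.coe_inj, coe_clock_of_ge this, coe_clock_of_ge (this.trans hs')]
      rw [h1 _ hi', h1 i (by lia), sub_self]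
  const ω s t hst hs := by
    have hs' : (s : WithTop ℝ≥0) ≤ t := WithTop.coe_le_coe.2 hst
    have h1 : ∀ k, clock t (G.τ k ω) = clock s (G.τ k ω) := fun k => by
      rw [← WithTop.coe_inj, coe_clock_of_ge (hs k), coe_clock_of_ge ((hs k).trans hs')]
    unfold SimpleStrategy.integral
    simp only [stoppedProcess_apply, h1]

/-- Start, increments and final constancy determine a process, by telescoping along the stopped
trading times. A process can thus be recognised as an integral without touching the infinite sum. -/
lemma Represents.eq_integral {G : 𝔐.SimpleStrategy} {S V : ℝ≥0 → Ω → ℝ}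
    (h : Represents S G.c G.τ G.g V) (t : ℝ≥0) (ω : Ω) : V t ω = G.integral S t ω := by
  have key : ∀ N, V (clock t (G.τ N ω)) ω = G.c + ∑ n ∈ Finset.range N, G.g n ω *
      (S (clock t (G.τ (n + 1) ω)) ω - S (clock t (G.τ n ω)) ω) := by
    intro N
    induction N with
    | zero => simp [G.isProper.zero ω, clock_zero, h.start]
    | succ N ih =>
      rw [Finset.sum_range_succ, ← add_assoc, ← ih]
      rcases le_total (G.τ N ω) t with h1 | h1
      · rw [← h.incr N ω _ _ (coe_clock_of_ge h1).ge (clock_mono_right t (G.isProper.mono N ω))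
          (coe_clock_le _ _)]
        ring
      · rw [clock_of_le h1, clock_of_le (h1.trans (G.isProper.mono N ω))]
        ring
  obtain ⟨N, hN, hN'⟩ := G.isProper.exists_clock_eq t ω
  rw [integral_eq_sum G S (hN t le_rfl), ← key N]
  rcases le_total (t : WithTop ℝ≥0) (G.τ N ω) with h1 | h1
  · rw [clock_of_le h1]
  · refine h.const ω _ t (clock_le _ _) fun n => ?_
    rw [coe_clock_of_ge h1]
    rcases hN' with h2 | h2
    · exact absurd h1 h2.not_ge
    · rcases le_total n N with h3 | h3
      · exact mono_of_le_succ G.isProper.mono ω h3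
      · exact (h2 n h3).le

/-- `V` is the capital process of a simple strategy trading in `S`. -/
def IsIntegral (𝔐 : MartingaleSpace Ω d) (S V : ℝ≥0 → Ω → ℝ) : Prop :=
  ∃ G : 𝔐.SimpleStrategy, ∀ t ω, V t ω = G.integral S t ω

lemma isIntegral_iff {S V : ℝ≥0 → Ω → ℝ} : 𝔐.IsIntegral S V ↔
    ∃ c σ g, 𝔐.IsProper σ ∧ 𝔐.Admissible σ g ∧ Represents S c σ g V := by
  constructor
  · rintro ⟨G, hG⟩
    refine ⟨G.c, G.τ, G.g, G.isProper, ⟨G.bounded_g, fun n _ => G.measurable_g n, G.g_eq_zero⟩, ?_⟩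
    obtain rfl : V = G.integral S := by ext t ω; exact hG t ω
    exact represents_integral G S
  · rintro ⟨c, σ, g, hσ, hg, hV⟩
    exact ⟨⟨c, σ, hσ, g, hg.bounded, fun n => hg.measurable n _, hg.eq_zero⟩,
      Represents.eq_integral hV⟩

lemma isSimpleCapital_iff {V : ℝ≥0 → Ω → ℝ} : 𝔐.IsSimpleCapital V ↔
    ∃ W : Fin d → ℝ≥0 → Ω → ℝ, (∀ j, 𝔐.IsIntegral (𝔐.S j) (W j)) ∧
      ∀ t ω, V t ω = ∑ j, W j t ω := by
  constructor
  · rintro ⟨G, hG⟩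
    exact ⟨fun j => (G j).integral (𝔐.S j), fun j => ⟨G j, fun _ _ => rfl⟩, hG⟩
  · rintro ⟨W, hW, hV⟩
    choose G hG using hW
    exact ⟨G, fun t ω => by simp only [hV, hG]⟩

/-! ### Bounded positions known at a stopping time -/

/-- `f` is a bounded random variable known at the stopping time `τ`. -/
structure IsKnownAt (𝔐 : MartingaleSpace Ω d) (τ : Ω → WithTop ℝ≥0) (f : Ω → ℝ) : Prop where
  bounded : ∃ K : ℝ, ∀ ω, |f ω| ≤ K
  measurable : ∀ h : IsStoppingTime 𝔐.filt τ, Measurable[h.measurableSpace] f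

lemma IsKnownAt.mono {τ ρ : Ω → WithTop ℝ≥0} {f : Ω → ℝ} (hf : 𝔐.IsKnownAt τ f)
    (hτ : IsStoppingTime 𝔐.filt τ) (h : ∀ ω, τ ω ≤ ρ ω) : 𝔐.IsKnownAt ρ f :=
  ⟨hf.bounded, fun hρ => (hf.measurable hτ).mono (hτ.measurableSpace_mono hρ h) le_rfl⟩

lemma IsKnownAt.mul {τ : Ω → WithTop ℝ≥0} {f f' : Ω → ℝ} (hf : 𝔐.IsKnownAt τ f)
    (hf' : 𝔐.IsKnownAt τ f') : 𝔐.IsKnownAt τ fun ω => f ω * f' ω := by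
  refine ⟨?_, fun h => (hf.measurable h).mul (hf'.measurable h)⟩
  obtain ⟨K, hK⟩ := hf.bounded
  obtain ⟨K', hK'⟩ := hf'.bounded
  refine ⟨K * K', fun ω => ?_⟩
  rw [abs_mul]
  exact mul_le_mul (hK ω) (hK' ω) (abs_nonneg _) ((abs_nonneg _).trans (hK ω))

lemma IsKnownAt.add {τ : Ω → WithTop ℝ≥0} {f f' : Ω → ℝ} (hf : 𝔐.IsKnownAt τ f)
    (hf' : 𝔐.IsKnownAt τ f') : 𝔐.IsKnownAt τ fun ω => f ω + f' ω := by
  refine ⟨?_, fun h => (hf.measurable h).add (hf'.measurable h)⟩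
  obtain ⟨K, hK⟩ := hf.bounded
  obtain ⟨K', hK'⟩ := hf'.bounded
  exact ⟨K + K', fun ω => (abs_add_le _ _).trans (add_le_add (hK ω) (hK' ω))⟩

lemma IsKnownAt.const (τ : Ω → WithTop ℝ≥0) (a : ℝ) : 𝔐.IsKnownAt τ fun _ => a :=
  ⟨⟨|a|, fun _ => le_rfl⟩, fun _ => measurable_const⟩

/-- Where `τ ≤ ρ`, the value of `f` is already revealed at `ρ`, and the event `τ ≤ ρ` is itself
decided by then. -/
lemma IsKnownAt.ite_le {τ ρ : Ω → WithTop ℝ≥0} {f f' : Ω → ℝ} (hτ : IsStoppingTime 𝔐.filt τ)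
    (hf : 𝔐.IsKnownAt τ f) (hf' : 𝔐.IsKnownAt ρ f')
    [∀ ω, Decidable (τ ω ≤ ρ ω)] :
    𝔐.IsKnownAt ρ fun ω => if τ ω ≤ ρ ω then f ω else f' ω := by
  refine ⟨?_, fun h => ?_⟩
  · obtain ⟨K, hK⟩ := hf.bounded
    obtain ⟨K', hK'⟩ := hf'.bounded
    refine ⟨max K K', fun ω => ?_⟩
    split_ifs
    · exact (hK ω).trans (le_max_left _ _)
    · exact (hK' ω).trans (le_max_right _ _)
  · intro A hA
    have h1 : MeasurableSet[h.measurableSpace] {ω | τ ω ≤ ρ ω} :=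
      IsStoppingTime.measurableSet_stopping_time_le hτ h
    have h2 := IsStoppingTime.measurableSet_inter_le hτ h _ (hf.measurable hτ hA)
    have h3 : MeasurableSet[h.measurableSpace] (f ⁻¹' A ∩ {ω | τ ω ≤ ρ ω}) :=
      (hτ.min h).measurableSpace_mono h (fun ω => min_le_right _ _) _ h2
    have h4 := (hf'.measurable h hA).diff h1
    convert h3.union h4 using 1
    ext ω
    by_cases hω : τ ω ≤ ρ ω <;> simp [hω]

lemma Admissible.isKnownAt {σ : ℕ → Ω → WithTop ℝ≥0} {g : ℕ → Ω → ℝ} (h : 𝔐.Admissible σ g)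
    (n : ℕ) : 𝔐.IsKnownAt (σ n) (g n) := ⟨h.bounded n, h.measurable n⟩

lemma admissible_of_isKnownAt {σ : ℕ → Ω → WithTop ℝ≥0} {g : ℕ → Ω → ℝ}
    (h : ∀ n, 𝔐.IsKnownAt (σ n) (g n)) (h0 : ∀ n ω, σ n ω = ⊤ → g n ω = 0) : 𝔐.Admissible σ g :=
  ⟨fun n => (h n).bounded, fun n => (h n).measurable, h0⟩

/-! ### Inserting a trading time -/

/-- The sequence `σ` with the time `τ` inserted. -/
noncomputable def insertTime (σ : ℕ → Ω → WithTop ℝ≥0) (τ : Ω → WithTop ℝ≥0) :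
    ℕ → Ω → WithTop ℝ≥0
  | 0 => σ 0
  | n + 1 => fun ω => min (σ (n + 1) ω) (max (σ n ω) (τ ω))

/-- The positions that correspond to `g` after the insertion of the time `τ`. -/
noncomputable def insertPos (σ : ℕ → Ω → WithTop ℝ≥0) (τ : Ω → WithTop ℝ≥0) (g : ℕ → Ω → ℝ) :
    ℕ → Ω → ℝ
  | 0 => g 0
  | n + 1 => fun ω => if σ (n + 1) ω ≤ τ ω then g (n + 1) ω else g n ω

section Insert

variable {σ : ℕ → Ω → WithTop ℝ≥0} {τ : Ω → WithTop ℝ≥0} {g : ℕ → Ω → ℝ}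

/-- The new sequence follows `σ` up to `τ`, visits `τ`, and then repeats `σ` with a delay of one
index. Together with `insertTime_le` this interlacing yields monotonicity and divergence. -/
lemma le_insertTime_succ (hσ : ∀ n ω, σ n ω ≤ σ (n + 1) ω) (n : ℕ) (ω : Ω) :
    σ n ω ≤ insertTime σ τ (n + 1) ω := le_min (hσ n ω) (le_max_left _ _)

lemma insertTime_le (n : ℕ) (ω : Ω) : insertTime σ τ n ω ≤ σ n ω := by
  cases n with
  | zero => exact le_rfl
  | succ n => exact min_le_left _ _

lemma isProper_insertTime (hσ : 𝔐.IsProper σ) (hτ : IsStoppingTime 𝔐.filt τ) :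
    𝔐.IsProper (insertTime σ τ) where
  isStoppingTime n := by
    cases n with
    | zero => exact hσ.isStoppingTime 0
    | succ n => exact (hσ.isStoppingTime _).min ((hσ.isStoppingTime _).max hτ)
  mono n ω := (insertTime_le n ω).trans (le_insertTime_succ hσ.mono n ω)
  zero ω := hσ.zero ω
  proper ω := by
    rcases hσ.proper ω with h | ⟨N, h⟩
    · left
      intro t
      obtain ⟨N, hN⟩ := h t
      refine ⟨N + 1, fun n hn => ?_⟩
      obtain ⟨n, rfl⟩ : ∃ k, n = k + 1 := ⟨n - 1, by lia⟩
      exact (hN n (by lia)).trans_le (le_insertTime_succ hσ.mono n ω)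
    · right
      refine ⟨N + 1, fun n hn => ?_⟩
      obtain ⟨n, rfl⟩ : ∃ k, n = k + 1 := ⟨n - 1, by lia⟩
      simp only [insertTime]
      rw [h (n + 1) (by lia), h n (by lia), h (N + 1) (by lia)]

lemma admissible_insertPos (hσ : 𝔐.IsProper σ) (hτ : IsStoppingTime 𝔐.filt τ)
    (hg : 𝔐.Admissible σ g) : 𝔐.Admissible (insertTime σ τ) (insertPos σ τ g) := by
  have hσ' := isProper_insertTime hσ hτ
  refine admissible_of_isKnownAt (fun n => ?_) fun n ω hn => ?_
  · cases n with
    | zero => exact hg.isKnownAt 0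
    | succ n =>
      have h1 : 𝔐.IsKnownAt (insertTime σ τ (n + 1)) (g n) :=
        (hg.isKnownAt n).mono (hσ.isStoppingTime n) (le_insertTime_succ hσ.mono n)
      have h2 := IsKnownAt.ite_le (hσ.isStoppingTime (n + 1))
        (hg.isKnownAt (n + 1)) (IsKnownAt.const (𝔐 := 𝔐) (insertTime σ τ (n + 1)) 0)
      have h3 : 𝔐.IsKnownAt (insertTime σ τ (n + 1))
          (fun ω => if σ (n + 1) ω ≤ τ ω then (1 : ℝ) else 0) := by
        have h4 := IsStoppingTime.measurableSet_stopping_time_le_min (hσ.isStoppingTime (n + 1)) hτ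
        refine ⟨⟨1, fun ω => by split_ifs <;> simp⟩, fun h => ?_⟩
        have h5 := ((hσ.isStoppingTime (n + 1)).min hτ).measurableSpace_mono h (fun ω => by
          exact min_le_min_left _ (le_max_right _ _)) _ h4
        exact Measurable.ite h5 measurable_const measurable_const
      -- With `A = {σ_{n+1} ≤ τ}` the position is `1_A g_{n+1} - 1_A g_n + g_n`. As `g_{n+1}` need
      -- not be known at the new time, `h2` first cuts it down to the event that `σ_{n+1}` has come
      -- by then, which contains `A`.
      have h6 := ((h3.mul h2).add (((IsKnownAt.const _ (-1)).mul h3).mul h1)).add h1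
      convert h6 using 1
      ext ω
      simp only [insertPos, insertTime]
      by_cases hω : σ (n + 1) ω ≤ τ ω
      · simp [hω]
      · simp [hω]
  · cases n with
    | zero => exact hg.eq_zero 0 ω hn
    | succ n =>
      simp only [insertTime, min_eq_top, max_eq_top] at hn
      simp only [insertPos]
      rcases hn.2 with h | h
      · rw [hg.eq_zero _ _ hn.1, hg.eq_zero _ _ h, ite_self]
      · rw [if_pos (by rw [h]; exact le_top), hg.eq_zero _ _ hn.1]

lemma Represents.insert {S V : ℝ≥0 → Ω → ℝ} {c : ℝ} (hσ : 𝔐.IsProper σ)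
    (h : Represents S c σ g V) (τ : Ω → WithTop ℝ≥0) :
    Represents S c (insertTime σ τ) (insertPos σ τ g) V where
  start := h.start
  const ω s t hst hs := h.const ω s t hst fun n =>
    (le_insertTime_succ hσ.mono n ω).trans (hs (n + 1))
  incr n ω s t hs hst ht := by
    cases n with
    | zero =>
      exact h.incr 0 ω s t hs hst (ht.trans (insertTime_le _ _))
    | succ n =>
      simp only [insertTime, insertPos] at hs ht ⊢
      split_ifs with h1
      · refine h.incr (n + 1) ω s t ?_ hst (ht.trans (min_le_left _ _))
        rwa [min_eq_left (h1.trans (le_max_right _ _))] at hs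
      · push Not at h1
        refine h.incr n ω s t ((le_min (hσ.mono n ω) (le_max_left _ _)).trans hs) hst ?_
        refine ht.trans ((min_le_right _ _).trans (max_le le_rfl h1.le))

/-- Says that no trading interval of the new sequence has `τ` strictly inside it. -/
lemma insertTime_separated (n : ℕ) (ω : Ω)
    (hn : ¬ τ ω ≤ insertTime σ τ n ω) : insertTime σ τ (n + 1) ω ≤ τ ω := by
  simp only [insertTime]
  cases n with
  | zero =>
    simp only [insertTime] at hn
    exact (min_le_right _ _).trans (max_le (le_of_not_ge hn) le_rfl)
  | succ n =>
    simp only [insertTime] at hn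
    push Not at hn
    refine (min_le_right _ _).trans (max_le ?_ le_rfl)
    rcases min_lt_iff.1 hn with h | h
    · exact h.le
    · exact absurd h (le_max_right _ _).not_gt

end Insert

/-- `V` and `N` are capital processes of strategies with the same trading times, the second with
initial capital `0`. -/
def JointIntegral (𝔐 : MartingaleSpace Ω d) (S V N : ℝ≥0 → Ω → ℝ) : Prop :=
  ∃ c σ g w, 𝔐.IsProper σ ∧ 𝔐.Admissible σ g ∧ 𝔐.Admissible σ w ∧
    Represents S c σ g V ∧ Represents S 0 σ w N

/-- Once `τ` is a trading time, every trading interval lies before or after `τ`, so holding `f`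
units of `V` from `τ` on means adding `f 1_{τ ≤ σ_n} g_n` to the position. Keeping `V` and `N` on
common times lets this be iterated without ever merging two arbitrary proper sequences. -/
lemma JointIntegral.step {S V N : ℝ≥0 → Ω → ℝ} (h : 𝔐.JointIntegral S V N)
    {τ : Ω → WithTop ℝ≥0} (hτ : IsStoppingTime 𝔐.filt τ) {f : Ω → ℝ} (hf : 𝔐.IsKnownAt τ f) :
    𝔐.JointIntegral S V fun t ω => N t ω + f ω * (V t ω - V (clock t (τ ω)) ω) := by
  obtain ⟨c, σ, g, w, hσ, hg, hw, hV, hN⟩ := h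
  have hσ' := isProper_insertTime hσ hτ
  have hg' := admissible_insertPos hσ hτ hg
  have hw' := admissible_insertPos hσ hτ hw
  have hV' := hV.insert hσ τ
  have hN' := hN.insert hσ τ
  have hsep := fun n ω => insertTime_separated (σ := σ) (τ := τ) n ω
  generalize insertTime σ τ = σ' at *
  generalize insertPos σ τ g = g' at *
  generalize insertPos σ τ w = w' at *
  refine ⟨c, σ', g', fun n ω => w' n ω + (if τ ω ≤ σ' n ω then f ω else 0) * g' n ω,
    hσ', hg', ?_, hV', ?_⟩
  · refine admissible_of_isKnownAt (fun n => ?_) fun n ω hn => ?_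
    · exact (hw'.isKnownAt n).add
        ((IsKnownAt.ite_le hτ hf (IsKnownAt.const _ 0)).mul
          (hg'.isKnownAt n))
    · rw [hw'.eq_zero _ _ hn, hg'.eq_zero _ _ hn]; simp
  · refine ⟨fun ω => ?_, fun n ω s t hs hst ht => ?_, fun ω s t hst hs => ?_⟩
    · simp [zero_clock, hN'.start]
    · have hs' : (s : WithTop ℝ≥0) ≤ t := WithTop.coe_le_coe.2 hst
      have h1 := hN'.incr n ω s t hs hst ht
      have h2 := hV'.incr n ω s t hs hst ht
      split_ifs with h3
      · have h4 : clock t (τ ω) = clock s (τ ω) := by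
          rw [← WithTop.coe_inj, coe_clock_of_ge (h3.trans hs),
            coe_clock_of_ge ((h3.trans hs).trans hs')]
        rw [h4]
        linear_combination h1 + f ω * h2
      · have h4 := ht.trans (hsep n ω h3)
        rw [clock_of_le h4, clock_of_le (hs'.trans h4)]
        linear_combination h1
    · have hs' : (s : WithTop ℝ≥0) ≤ t := WithTop.coe_le_coe.2 hst
      have h1 := hN'.const ω s t hst hs
      have h2 := hV'.const ω s t hst hs
      have h3 : V (clock t (τ ω)) ω = V (clock s (τ ω)) ω := by
        rcases le_total (τ ω) s with h4 | h4
        · congr 1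
          rw [← WithTop.coe_inj, coe_clock_of_ge h4, coe_clock_of_ge (h4.trans hs')]
        · rw [clock_of_le h4]
          refine hV'.const ω s _ ?_ hs
          rw [← WithTop.coe_le_coe, coe_clock]
          exact le_min hs' h4
      rw [h1, h2, h3]

lemma IsIntegral.joint {S V : ℝ≥0 → Ω → ℝ} (h : 𝔐.IsIntegral S V) :
    𝔐.JointIntegral S V fun _ _ => 0 := by
  obtain ⟨c, σ, g, hσ, hg, hV⟩ := isIntegral_iff.1 h
  refine ⟨c, σ, g, fun _ _ => 0, hσ, hg, ⟨fun _ => ⟨0, by simp⟩, fun _ _ => measurable_const,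
    fun _ _ _ => rfl⟩, hV, ⟨fun _ => rfl, fun _ _ _ _ _ _ _ => by simp, fun _ _ _ _ _ => rfl⟩⟩

lemma Admissible.linear {σ : ℕ → Ω → WithTop ℝ≥0} {g w : ℕ → Ω → ℝ} (hg : 𝔐.Admissible σ g)
    (hw : 𝔐.Admissible σ w) (a b : ℝ) :
    𝔐.Admissible σ fun n ω => a * g n ω + b * w n ω := by
  refine admissible_of_isKnownAt (fun n => ?_) fun n ω hn => ?_
  · exact ((IsKnownAt.const _ a).mul (hg.isKnownAt n)).add
      ((IsKnownAt.const _ b).mul (hw.isKnownAt n))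
  · simp [hg.eq_zero n ω hn, hw.eq_zero n ω hn]

lemma JointIntegral.isIntegral {S V N : ℝ≥0 → Ω → ℝ} (h : 𝔐.JointIntegral S V N) (a b e : ℝ) :
    𝔐.IsIntegral S fun t ω => e + (a * V t ω + b * N t ω) := by
  obtain ⟨c, σ, g, w, hσ, hg, hw, hV, hN⟩ := h
  refine isIntegral_iff.2 ⟨e + a * c, σ, fun n ω => a * g n ω + b * w n ω, hσ,
    hg.linear hw a b, ⟨fun ω => ?_, fun n ω s t hs hst ht => ?_, fun ω s t hst hs => ?_⟩⟩
  · simp [hV.start, hN.start]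
  · linear_combination a * hV.incr n ω s t hs hst ht + b * hN.incr n ω s t hs hst ht
  · rw [hV.const ω s t hst hs, hN.const ω s t hst hs]

lemma isIntegral_const (𝔐 : MartingaleSpace Ω d) (S : ℝ≥0 → Ω → ℝ) (a : ℝ) :
    𝔐.IsIntegral S fun _ _ => a := by
  refine isIntegral_iff.2 ⟨a, fun _ _ => 0, fun _ _ => 0, ⟨fun n => ?_, fun _ _ => le_rfl,
    fun _ => rfl, fun _ => Or.inr ⟨0, fun _ _ => rfl⟩⟩, ⟨fun _ => ⟨0, by simp⟩,
    fun _ _ => measurable_const, fun _ _ _ => rfl⟩, ⟨fun _ => rfl, fun _ _ _ _ _ _ _ => by simp,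
    fun _ _ _ _ _ => rfl⟩⟩
  exact isStoppingTime_const 𝔐.filt 0

lemma IsIntegral.linear {S V : ℝ≥0 → Ω → ℝ} (h : 𝔐.IsIntegral S V) (a e : ℝ) :
    𝔐.IsIntegral S fun t ω => a * V t ω + e := by
  convert h.joint.isIntegral a 0 e using 3
  ring

/-- `V^τ = V - (V - V^τ)`, where the bracket is one application of `JointIntegral.step` with `f =
1`. -/
lemma IsIntegral.stopped {S V : ℝ≥0 → Ω → ℝ} (h : 𝔐.IsIntegral S V) {τ : Ω → WithTop ℝ≥0}
    (hτ : IsStoppingTime 𝔐.filt τ) : 𝔐.IsIntegral S fun t ω => V (clock t (τ ω)) ω := by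
  convert (h.joint.step hτ (IsKnownAt.const τ 1)).isIntegral 1 (-1) 0 using 3
  ring

/-! ### Step integrals of simple capital processes -/

/-- The integral over `[0, t ∧ T]` of the step integrand with values `f_l` on `(τ_l, τ_{l+1}]`,
`l < k`. -/
noncomputable def stepIntegral (τ : ℕ → Ω → WithTop ℝ≥0) (f : ℕ → Ω → ℝ) (k : ℕ)
    (T : Ω → WithTop ℝ≥0) (x : ℝ≥0 → Ω → ℝ) (t : ℝ≥0) (ω : Ω) : ℝ :=
  ∑ l ∈ Finset.range k, f l ω *
    (x (clock t (min (T ω) (τ (l + 1) ω))) ω - x (clock t (min (T ω) (τ l ω))) ω)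

/-- The data of a step integral: a non-decreasing sequence of stopping times with bounded known
positions. -/
structure StepData (𝔐 : MartingaleSpace Ω d) (τ : ℕ → Ω → WithTop ℝ≥0) (f : ℕ → Ω → ℝ) :
    Prop where
  isStoppingTime : ∀ n, IsStoppingTime 𝔐.filt (τ n)
  mono : ∀ n ω, τ n ω ≤ τ (n + 1) ω
  isKnownAt : ∀ n, 𝔐.IsKnownAt (τ n) (f n)

/-- `V^{τ_{l+1}} - V^{τ_l} = (V - V^{τ_l}) - (V - V^{τ_{l+1}})`: buy `f_l` units at `τ_l` and sell
them at `τ_{l+1}`, which takes two insertions. -/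
lemma JointIntegral.stepIntegral {S V : ℝ≥0 → Ω → ℝ} (h : 𝔐.IsIntegral S V)
    {τ : ℕ → Ω → WithTop ℝ≥0} {f : ℕ → Ω → ℝ} (hd : 𝔐.StepData τ f) (k : ℕ) :
    𝔐.JointIntegral S V fun t ω => ∑ l ∈ Finset.range k, f l ω *
      (V (clock t (τ (l + 1) ω)) ω - V (clock t (τ l ω)) ω) := by
  induction k with
  | zero => simpa using h.joint
  | succ k ih =>
    have h1 := (ih.step (hd.isStoppingTime k) (hd.isKnownAt k)).step (hd.isStoppingTime (k + 1))
      ((IsKnownAt.const _ (-1)).mul ((hd.isKnownAt k).mono (hd.isStoppingTime k) (hd.mono k)))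
    convert h1 using 3
    rw [Finset.sum_range_succ]
    ring

lemma IsIntegral.stepIntegral {S V : ℝ≥0 → Ω → ℝ} (h : 𝔐.IsIntegral S V)
    {τ : ℕ → Ω → WithTop ℝ≥0} {f : ℕ → Ω → ℝ} (hd : 𝔐.StepData τ f) (k : ℕ)
    {T : Ω → WithTop ℝ≥0} (hT : IsStoppingTime 𝔐.filt T) :
    𝔐.IsIntegral S (stepIntegral τ f k T V) := by
  convert (JointIntegral.stepIntegral (h.stopped hT) hd k).isIntegral 0 1 0 using 3 with t ω
  simp only [MartingaleSpace.stepIntegral, clock_clock, min_comm (T ω)]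
  ring

lemma IsSimpleCapital.stepIntegral {V : ℝ≥0 → Ω → ℝ} (h : 𝔐.IsSimpleCapital V)
    {τ : ℕ → Ω → WithTop ℝ≥0} {f : ℕ → Ω → ℝ} (hd : 𝔐.StepData τ f) (k : ℕ)
    {T : Ω → WithTop ℝ≥0} (hT : IsStoppingTime 𝔐.filt T) :
    𝔐.IsSimpleCapital (stepIntegral τ f k T V) := by
  obtain ⟨W, hW, hV⟩ := isSimpleCapital_iff.1 h
  refine isSimpleCapital_iff.2 ⟨_, fun j => (hW j).stepIntegral hd k hT, fun t ω => ?_⟩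
  simp only [MartingaleSpace.stepIntegral, hV]
  rw [Finset.sum_comm]
  simp only [← Finset.sum_sub_distrib, Finset.mul_sum]

lemma IsSimpleCapital.stopped {V : ℝ≥0 → Ω → ℝ} (h : 𝔐.IsSimpleCapital V)
    {T : Ω → WithTop ℝ≥0} (hT : IsStoppingTime 𝔐.filt T) :
    𝔐.IsSimpleCapital fun t ω => V (clock t (T ω)) ω := by
  obtain ⟨W, hW, hV⟩ := isSimpleCapital_iff.1 h
  exact isSimpleCapital_iff.2 ⟨_, fun j => (hW j).stopped hT, fun t ω => hV _ ω⟩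

lemma IsSimpleCapital.const_mul {V : ℝ≥0 → Ω → ℝ} (h : 𝔐.IsSimpleCapital V) (a : ℝ) :
    𝔐.IsSimpleCapital fun t ω => a * V t ω := by
  obtain ⟨W, hW, hV⟩ := isSimpleCapital_iff.1 h
  exact isSimpleCapital_iff.2 ⟨_, fun j => (hW j).linear a 0, fun t ω => by
    simp [hV, Finset.mul_sum]⟩

lemma isSimpleCapital_const (hd : 0 < d) (𝔐 : MartingaleSpace Ω d) (a : ℝ) :
    𝔐.IsSimpleCapital fun _ _ => a := by
  -- The capital is split evenly among the `d` accounts; with `d = 0` only the zero process would be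
  -- available.
  refine isSimpleCapital_iff.2 ⟨_, fun j => isIntegral_const 𝔐 (𝔐.S j) (a / d), fun t ω => ?_⟩
  have : (d : ℝ) ≠ 0 := by positivity
  simp
  field_simp

/-! ### Closure properties of nonnegative supermartingales -/

lemma liminf_add_const_of_nonneg {u : ℕ → EReal} (hu : ∀ n, 0 ≤ u n) {y : EReal} (hy : 0 ≤ y) :
    liminf u atTop + y = liminf (fun n => u n + y) atTop := by
  have hl : 0 ≤ liminf u atTop := le_liminf_of_le (by isBoundedDefault) (Eventually.of_forall hu)
  rcases eq_or_ne y ⊤ with rfl | hy'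
  · rw [EReal.add_top_of_ne_bot (ne_of_gt (lt_of_lt_of_le EReal.bot_lt_zero hl))]
    have : ∀ n, u n + ⊤ = ⊤ := fun n =>
      EReal.add_top_of_ne_bot (ne_of_gt (lt_of_lt_of_le EReal.bot_lt_zero (hu n)))
    simp [this]
  · have hy0 : y ≠ ⊥ := ne_of_gt (lt_of_lt_of_le EReal.bot_lt_zero hy)
    refine Monotone.map_liminf_of_continuousAt (f := fun x => x + y)
      (fun a b h => add_le_add_left h y) u ?_
    exact (EReal.continuousAt_add (Or.inr hy0) (Or.inr hy')).comp
      (continuousAt_id.prodMk continuousAt_const)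

lemma IsSimpleCapital.exists_start {V : ℝ≥0 → Ω → ℝ} (h : 𝔐.IsSimpleCapital V) :
    ∃ c : ℝ, ∀ ω, V 0 ω = c := by
  obtain ⟨G, hG⟩ := h
  exact ⟨∑ j, (G j).c, fun ω => by simp only [hG, (represents_integral (G _) (𝔐.S _)).start ω]⟩

namespace IsNonnegSupermartingale

variable {X Y : ℝ≥0 → Ω → EReal}

lemma nonneg (h : 𝔐.IsNonnegSupermartingale X) : ∀ t ω, 0 ≤ X t ω := by
  induction h with
  | simple V hV h0 => exact fun t ω => EReal.coe_nonneg.2 (h0 t ω)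
  | add X V hX hV h0 ih => exact h0
  | liminf X hX ih =>
    exact fun t ω => le_liminf_of_le (by isBoundedDefault) (Eventually.of_forall fun n => ih n t ω)

lemma ne_bot (h : 𝔐.IsNonnegSupermartingale X) (t : ℝ≥0) (ω : Ω) : X t ω ≠ ⊥ :=
  ne_of_gt (lt_of_lt_of_le EReal.bot_lt_zero (h.nonneg t ω))

lemma exists_start (h : 𝔐.IsNonnegSupermartingale X) : ∃ x : EReal, ∀ ω, X 0 ω = x := by
  induction h with
  | simple V hV h0 =>
    obtain ⟨c, hc⟩ := hV.exists_start
    exact ⟨c, fun ω => by simp only [hc]⟩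
  | add X V hX hV h0 ih =>
    obtain ⟨c, hc⟩ := hV.exists_start
    obtain ⟨x, hx⟩ := ih
    exact ⟨x + c, fun ω => by simp only [hc, hx]⟩
  | liminf X hX ih =>
    choose x hx using ih
    exact ⟨Filter.liminf x atTop, fun ω => by simp only [hx]⟩

lemma stopped (h : 𝔐.IsNonnegSupermartingale X) {T : Ω → WithTop ℝ≥0}
    (hT : IsStoppingTime 𝔐.filt T) :
    𝔐.IsNonnegSupermartingale fun t ω => X (clock t (T ω)) ω := by
  induction h with
  | simple V hV h0 => exact .simple _ (hV.stopped hT) fun t ω => h0 _ ω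
  | add X V hX hV h0 ih => exact .add _ _ ih (hV.stopped hT) fun t ω => h0 _ ω
  | liminf X hX ih => exact .liminf _ ih

/-- Induction on `X` alone: each of the three constructors commutes with adding a fixed nonnegative
`Y`. -/
lemma add_process (hX : 𝔐.IsNonnegSupermartingale X) (hY : 𝔐.IsNonnegSupermartingale Y) :
    𝔐.IsNonnegSupermartingale fun t ω => X t ω + Y t ω := by
  induction hX with
  | simple V hV h0 =>
    simp only [add_comm (V _ _ : EReal)]
    exact .add _ _ hY hV fun t ω => add_nonneg (hY.nonneg t ω) (EReal.coe_nonneg.2 (h0 t ω))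
  | add X V hX hV h0 ih =>
    simp only [add_right_comm (X _ _)]
    refine .add _ _ ih hV fun t ω => ?_
    rw [add_right_comm]
    exact add_nonneg (h0 t ω) (hY.nonneg t ω)
  | liminf X hX ih =>
    simp only [liminf_add_const_of_nonneg (fun n => (hX n).nonneg _ _) (hY.nonneg _ _)]
    exact .liminf _ ih

lemma const_mul (hX : 𝔐.IsNonnegSupermartingale X) {a : ℝ} (ha : 0 ≤ a) :
    𝔐.IsNonnegSupermartingale fun t ω => (a : EReal) * X t ω := by
  have ha' : (0 : EReal) ≤ a := EReal.coe_nonneg.2 ha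
  induction hX with
  | simple V hV h0 =>
    simp only [← EReal.coe_mul]
    exact .simple _ (hV.const_mul a) fun t ω => mul_nonneg ha (h0 t ω)
  | add X V hX hV h0 ih =>
    have h1 : ∀ t ω, (a : EReal) * (X t ω + V t ω) = a * X t ω + (a * V t ω : ℝ) := fun t ω => by
      rw [EReal.left_distrib_of_nonneg_of_ne_top ha' (EReal.coe_ne_top a), EReal.coe_mul]
    simp only [h1]
    refine .add _ _ ih (hV.const_mul a) fun t ω => ?_
    rw [← h1]
    exact mul_nonneg ha' (h0 t ω)
  | liminf X hX ih =>
    simp only [← EReal.liminf_const_mul_of_nonneg_of_ne_top ha' (EReal.coe_ne_top a)]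
    exact .liminf _ ih

lemma const (hd : 0 < d) (𝔐 : MartingaleSpace Ω d) {a : ℝ} (ha : 0 ≤ a) :
    𝔐.IsNonnegSupermartingale fun _ _ => (a : EReal) :=
  .simple _ (isSimpleCapital_const hd 𝔐 a) fun _ _ => ha

end IsNonnegSupermartingale

/-! ### Properties that hold with instant enforcement -/

section Enforceable

lemma Enforceable.mono {E E' : Set (ℝ≥0 × Ω)} (h : 𝔐.Enforceable E) (hE : E ⊆ E') :
    𝔐.Enforceable E' := by
  obtain ⟨U, hU, hU0, hUE⟩ := h
  exact ⟨U, hU, hU0, fun t ω ht => hUE t ω fun h' => ht (hE h')⟩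

lemma enforceable_univ (hd : 0 < d) (𝔐 : MartingaleSpace Ω d) : 𝔐.Enforceable Set.univ :=
  ⟨_, .const hd 𝔐 zero_le_one, fun _ => by simp, fun _ _ h => absurd (Set.mem_univ _) h⟩

/-- An enforceable property can be enforced at an arbitrarily small cost. -/
lemma Enforceable.exists_small {E : Set (ℝ≥0 × Ω)} (h : 𝔐.Enforceable E) {δ : ℝ} (hδ : 0 < δ) :
    ∃ U : ℝ≥0 → Ω → EReal, 𝔐.IsNonnegSupermartingale U ∧ (∀ ω, U 0 ω = δ) ∧
      ∀ t ω, (t, ω) ∉ E → U t ω = ⊤ := by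
  obtain ⟨U, hU, hU0, hUE⟩ := h
  refine ⟨_, hU.const_mul hδ.le, fun ω => by rw [hU0, mul_one], fun t ω ht => ?_⟩
  rw [hUE t ω ht, EReal.coe_mul_top_of_pos hδ]

/-- The enforcing supermartingale has finite capital `1` at time `0`, so nothing can fail there. -/
lemma Enforceable.zero_mem {E : Set (ℝ≥0 × Ω)} (h : 𝔐.Enforceable E) (ω : Ω) : (0, ω) ∈ E := by
  obtain ⟨U, hU, hU0, hUE⟩ := h
  by_contra hω
  have := hUE 0 ω hω
  rw [hU0] at this
  exact absurd this (by decide)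

/-- Bet `2^{-(n+1)}` on the `n`-th property. An infinite sum is not one of the constructors, so the
`k`-th approximation holds the unspent `2^{-k}` in cash; every approximation then starts exactly
from `1`, and so does the `liminf`. -/
lemma Enforceable.iInter (hd : 0 < d) {E : ℕ → Set (ℝ≥0 × Ω)} (h : ∀ n, 𝔐.Enforceable (E n)) :
    𝔐.Enforceable (⋂ n, E n) := by
  choose U hU hU0 hUE using fun n => (h n).exists_small (δ := (1 / 2) ^ (n + 1)) (by positivity)
  have hsum : ∀ k, 𝔐.IsNonnegSupermartingale fun t ω =>
      (((1 / 2 : ℝ) ^ k : ℝ) : EReal) + ∑ n ∈ Finset.range k, U n t ω := by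
    have h1 : ∀ k, 𝔐.IsNonnegSupermartingale fun t ω => ∑ n ∈ Finset.range k, U n t ω := by
      intro k
      induction k with
      | zero => simpa using IsNonnegSupermartingale.const hd 𝔐 le_rfl
      | succ k ih =>
        simp only [Finset.sum_range_succ]
        exact ih.add_process (hU k)
    exact fun k => (IsNonnegSupermartingale.const hd 𝔐 (by positivity)).add_process (h1 k)
  refine ⟨_, .liminf _ hsum, fun ω => ?_, fun t ω ht => ?_⟩
  · have : ∀ k : ℕ, (((1 / 2 : ℝ) ^ k : ℝ) : EReal) + ∑ n ∈ Finset.range k, U n 0 ω = 1 := by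
      intro k
      have h2 : ∀ k : ℕ, ∑ n ∈ Finset.range k, U n 0 ω = ((1 - (1 / 2) ^ k : ℝ) : EReal) := by
        intro k
        induction k with
        | zero => simp
        | succ k ih =>
          rw [Finset.sum_range_succ, ih, hU0, ← EReal.coe_add]
          congr 1
          ring
      rw [h2, ← EReal.coe_add]
      simp
    simp only [this]
    exact liminf_const _
  · obtain ⟨n, hn⟩ : ∃ n, (t, ω) ∉ E n := by simpa using ht
    have : ∀ᶠ k in atTop,
        (((1 / 2 : ℝ) ^ k : ℝ) : EReal) + ∑ n ∈ Finset.range k, U n t ω = ⊤ := by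
      filter_upwards [eventually_gt_atTop n] with k hk
      have hnn : ∀ i ∈ Finset.range k, 0 ≤ U i t ω := fun i _ => (hU i).nonneg t ω
      have h3 : U n t ω ≤ ∑ n ∈ Finset.range k, U n t ω :=
        Finset.single_le_sum hnn (Finset.mem_range.2 hk)
      rw [hUE n t ω hn, top_le_iff] at h3
      rw [h3, EReal.coe_add_top]
    rw [liminf_congr this]
    exact liminf_const _

lemma Enforceable.inter (hd : 0 < d) {E E' : Set (ℝ≥0 × Ω)} (h : 𝔐.Enforceable E)
    (h' : 𝔐.Enforceable E') : 𝔐.Enforceable (E ∩ E') := by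
  refine (Enforceable.iInter hd (E := fun n => if n = 0 then E else E') fun n => ?_).mono ?_
  · split_ifs
    exacts [h, h']
  · intro p hp
    rw [Set.mem_iInter] at hp
    exact ⟨by simpa using hp 0, by simpa using hp 1⟩

end Enforceable

/-! ### Completeness of the filtration -/

section Complete

variable {E : Set (ℝ≥0 × Ω)} {t : ℝ≥0}

/-- Under the standing assumption the `σ`-field `ℱ_t` contains all sets of points that meet a
blockable set by the time `t`. -/
lemma AssumptionA.measurableSet_of_subset (hA : 𝔐.AssumptionA) (hE : 𝔐.Enforceable E)
    {N : Set Ω} (hN : ∀ ω ∈ N, ∃ s ≤ t, (s, ω) ∉ E) : MeasurableSet[𝔐.filt t] N := by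
  -- Subsets of blockable sets are blockable; the part of the complement of `E` lying over `N`
  -- projects, up to time `t`, exactly onto `N`.
  have h1 : 𝔐.Blockable {p | p ∉ E ∧ p.2 ∈ N} :=
    hE.mono fun p hp h => h.1 hp
  convert hA t _ h1 using 1
  ext ω
  constructor
  · intro hω
    obtain ⟨s, hs, h2⟩ := hN ω hω
    exact ⟨s, hs, h2, hω⟩
  · rintro ⟨s, -, -, h2⟩
    exact h2

lemma AssumptionA.measurableSet_congr (hA : 𝔐.AssumptionA) (hE : 𝔐.Enforceable E)
    {A A' : Set Ω} (hA' : MeasurableSet[𝔐.filt t] A')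
    (h : ∀ ω, (∀ s ≤ t, (s, ω) ∈ E) → (ω ∈ A ↔ ω ∈ A')) : MeasurableSet[𝔐.filt t] A := by
  have h1 : MeasurableSet[𝔐.filt t] {ω | ∃ s ≤ t, (s, ω) ∉ E} :=
    hA.measurableSet_of_subset hE fun ω hω => hω
  have h2 : MeasurableSet[𝔐.filt t] (A ∩ {ω | ∃ s ≤ t, (s, ω) ∉ E}) :=
    hA.measurableSet_of_subset hE fun ω hω => hω.2
  convert (hA'.diff h1).union h2 using 1
  ext ω
  by_cases hω : ∃ s ≤ t, (s, ω) ∉ E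
  · have hω' := hω
    simp only [Set.mem_union, Set.mem_sdiff, Set.mem_inter_iff, Set.mem_ofPred_eq, hω, not_true_eq_false,
      and_false, and_true, false_or]
  · simp only [Set.mem_union, Set.mem_sdiff, Set.mem_inter_iff, Set.mem_ofPred_eq, hω,
      not_false_eq_true, and_false, and_true, or_false, h ω (by simpa using hω)]

lemma AssumptionA.measurable_congr (hA : 𝔐.AssumptionA) (hE : 𝔐.Enforceable E)
    {f f' : Ω → ℝ} (hf' : Measurable[𝔐.filt t] f')
    (h : ∀ ω, (∀ s ≤ t, (s, ω) ∈ E) → f ω = f' ω) : Measurable[𝔐.filt t] f := fun A hA' =>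
  hA.measurableSet_congr hE (hf' hA') fun ω hω => by simp [h ω hω]

end Complete

/-! ### Regular processes and hitting times -/

/-- `z` is adapted, and for `(t, ω) ∈ E` its trajectory is continuous on `[0, t]`. -/
structure IsRegular (𝔐 : MartingaleSpace Ω d) (E : Set (ℝ≥0 × Ω)) (z : ℝ≥0 → Ω → ℝ) : Prop where
  measurable : ∀ t, Measurable[𝔐.filt t] (z t)
  continuousOn : ∀ t ω, (t, ω) ∈ E → ContinuousOn (fun s => z s ω) (Set.Iic t)

/-- The process `z` stopped at `t`, and killed on the trajectories that leave `E` by the time `t`. -/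
noncomputable def killed (E : Set (ℝ≥0 × Ω)) (t : ℝ≥0) (z : ℝ≥0 → Ω → ℝ) (r : ℝ≥0) (ω : Ω) : ℝ :=
  open scoped Classical in if ∀ s ≤ t, (s, ω) ∈ E then z (min r t) ω else 0

section Regular

variable {E : Set (ℝ≥0 × Ω)} {z : ℝ≥0 → Ω → ℝ}

lemma IsRegular.mono {E' : Set (ℝ≥0 × Ω)} (hz : 𝔐.IsRegular E z) (h : E' ⊆ E) :
    𝔐.IsRegular E' z :=
  ⟨hz.measurable, fun t ω hω => hz.continuousOn t ω (h hω)⟩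

lemma IsRegular.sub {z' : ℝ≥0 → Ω → ℝ} (hz : 𝔐.IsRegular E z) (hz' : 𝔐.IsRegular E z') :
    𝔐.IsRegular E fun t ω => z t ω - z' t ω :=
  ⟨fun t => (hz.measurable t).sub (hz'.measurable t),
    fun t ω hω => (hz.continuousOn t ω hω).sub (hz'.continuousOn t ω hω)⟩

lemma continuous_killed (hz : 𝔐.IsRegular E z) (t : ℝ≥0) (ω : Ω) :
    Continuous fun r => killed E t z r ω := by
  unfold killed
  split_ifs with h
  · exact (hz.continuousOn t ω (h t le_rfl)).comp_continuous
      (continuous_id.min continuous_const) fun r => Set.mem_Iic.2 (min_le_right _ _)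
  · exact continuous_const

lemma measurable_killed (hA : 𝔐.AssumptionA) (hE : 𝔐.Enforceable E) (hz : 𝔐.IsRegular E z)
    (t r : ℝ≥0) : Measurable[𝔐.filt t] (killed E t z r) := by
  refine hA.measurable_congr hE
    ((hz.measurable (min r t)).mono (𝔐.filt.mono (min_le_right _ _)) le_rfl) fun ω hω => ?_
  simp only [killed]
  rw [if_pos hω]

lemma killed_of_le {t r : ℝ≥0} (hr : r ≤ t) {ω : Ω} (hω : ∀ s ≤ t, (s, ω) ∈ E) :
    killed E t z r ω = z r ω := by
  simp only [killed]
  rw [if_pos hω, min_eq_left hr]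

lemma measurable_clock {τ : Ω → WithTop ℝ≥0} (hτ : IsStoppingTime 𝔐.filt τ) (t : ℝ≥0) :
    Measurable[𝔐.filt t] fun ω => clock t (τ ω) := by
  refine measurable_of_Iic fun s => ?_
  rcases le_or_gt t s with h | h
  · convert MeasurableSet.univ using 1
    exact Set.eq_univ_of_forall fun ω => (clock_le _ _).trans h
  · convert 𝔐.filt.mono h.le _ (hτ s) using 1
    ext ω
    simp only [Set.mem_preimage, Set.mem_Iic, Set.mem_ofPred_eq]
    rw [← WithTop.coe_le_coe, coe_clock, min_le_iff, WithTop.coe_le_coe]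
    simp [h.not_ge]

/-- The killed process is continuous in time on every trajectory and `ℱ_t`-measurable at each time,
hence jointly measurable, and can be composed with `ω ↦ (t ∧ τ, ω)`. It differs from `z` only on
trajectories that leave `E` by time `t`. -/
lemma IsRegular.measurable_stopped (hA : 𝔐.AssumptionA) (hE : 𝔐.Enforceable E)
    (hz : 𝔐.IsRegular E z) {τ : Ω → WithTop ℝ≥0} (hτ : IsStoppingTime 𝔐.filt τ) (t : ℝ≥0) :
    Measurable[𝔐.filt t] fun ω => z (clock t (τ ω)) ω := by
  have h1 : @Measurable (ℝ≥0 × Ω) ℝ (@Prod.instMeasurableSpace _ _ _ (𝔐.filt t)) _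
      (Function.uncurry (killed E t z)) :=
    @measurable_uncurry_of_continuous_of_measurable Ω ℝ ℝ≥0 _ _ _ _ _ _ _ _ _ (𝔐.filt t) _
      (continuous_killed hz t) (measurable_killed hA hE hz t)
  have h2 : @Measurable Ω (ℝ≥0 × Ω) (𝔐.filt t) (@Prod.instMeasurableSpace _ _ _ (𝔐.filt t))
      fun ω => (clock t (τ ω), ω) :=
    @Measurable.prodMk _ (𝔐.filt t) _ _ _ (𝔐.filt t) (fun ω => clock t (τ ω)) (fun ω => ω)
      (measurable_clock hτ t) (@measurable_id _ (𝔐.filt t))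
  refine hA.measurable_congr hE (h1.comp h2) fun ω hω => ?_
  exact (killed_of_le (clock_le _ _) hω).symm

lemma IsRegular.stopped (hA : 𝔐.AssumptionA) (hE : 𝔐.Enforceable E)
    (hz : 𝔐.IsRegular E z) {τ : Ω → WithTop ℝ≥0} (hτ : IsStoppingTime 𝔐.filt τ) :
    𝔐.IsRegular E fun t ω => z (clock t (τ ω)) ω :=
  ⟨hz.measurable_stopped hA hE hτ, fun t ω hω => (hz.continuousOn t ω hω).comp
    (continuous_clock (τ ω)).continuousOn fun _ hs => Set.mem_Iic.2 ((clock_le _ _).trans hs)⟩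

/-- The factor `y` vanishes before `τ`, so `f` matters only on `{τ ≤ t}`, where it is known at time
`t`. -/
lemma IsKnownAt.measurable_mul {τ : Ω → WithTop ℝ≥0} {f : Ω → ℝ} (hf : 𝔐.IsKnownAt τ f)
    (hτ : IsStoppingTime 𝔐.filt τ) {t : ℝ≥0} {y : Ω → ℝ} (hy : Measurable[𝔐.filt t] y)
    (h : ∀ ω, (t : WithTop ℝ≥0) < τ ω → y ω = 0) : Measurable[𝔐.filt t] fun ω => f ω * y ω := by
  have h1 : Measurable[𝔐.filt t] fun ω => if τ ω ≤ t then f ω else 0 := by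
    intro A hA
    have h2 := ((hτ.measurableSet _).1 (hf.measurable hτ hA)).2 t
    have h3 : MeasurableSet[𝔐.filt t] ({ω | τ ω ≤ t}ᶜ ∩ {_ω : Ω | (0 : ℝ) ∈ A}) :=
      (hτ t).compl.inter (MeasurableSet.const _)
    convert h2.union h3 using 1
    ext ω
    change (if τ ω ≤ t then f ω else 0) ∈ A ↔ (f ω ∈ A ∧ τ ω ≤ t) ∨ (¬ τ ω ≤ t ∧ (0 : ℝ) ∈ A)
    split_ifs with hω <;> tauto
  convert h1.mul hy using 1
  ext ω
  by_cases hω : τ ω ≤ t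
  · rw [Pi.mul_apply, if_pos hω]
  · rw [Pi.mul_apply, h ω (lt_of_not_ge hω), mul_zero, mul_zero]

lemma StepData.isRegular_stepIntegral (hA : 𝔐.AssumptionA) (hE : 𝔐.Enforceable E)
    (hz : 𝔐.IsRegular E z) {τ : ℕ → Ω → WithTop ℝ≥0} {f : ℕ → Ω → ℝ} (hd : 𝔐.StepData τ f)
    (k : ℕ) {T : Ω → WithTop ℝ≥0} (hT : IsStoppingTime 𝔐.filt T) :
    𝔐.IsRegular E (stepIntegral τ f k T z) := by
  have h1 : ∀ l, 𝔐.IsRegular E fun t ω => z (clock t (min (T ω) (τ (l + 1) ω))) ω -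
      z (clock t (min (T ω) (τ l ω))) ω := fun l =>
    (hz.stopped hA hE (hT.min (hd.isStoppingTime (l + 1)))).sub
      (hz.stopped hA hE (hT.min (hd.isStoppingTime l)))
  refine ⟨fun t => ?_, fun t ω hω => ?_⟩
  · refine Finset.measurable_sum _ fun l _ => ?_
    refine (hd.isKnownAt l).measurable_mul (hd.isStoppingTime l) ((h1 l).measurable t) fun ω hω => ?_
    have h2 : clock t (min (T ω) (τ (l + 1) ω)) = clock t (min (T ω) (τ l ω)) := by
      rw [← WithTop.coe_inj, coe_clock, coe_clock, min_left_comm, min_left_comm (t : WithTop ℝ≥0),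
        min_eq_left hω.le, min_eq_left (hω.le.trans (hd.mono l ω))]
    rw [h2, sub_self]
  · exact continuousOn_finsetSum _ fun l _ => continuousOn_const.mul ((h1 l).continuousOn t ω hω)

/-- The first time when `|z| ≥ ε`, if there is one, and `∞` otherwise. -/
noncomputable def hit (ε : ℝ) (z : ℝ≥0 → Ω → ℝ) (ω : Ω) : WithTop ℝ≥0 :=
  open scoped Classical in
  if h : ∃ s : ℝ≥0, IsLeast {s | ε ≤ |z s ω|} s then (h.choose : WithTop ℝ≥0) else ⊤

/-- Needs no continuity, since a finite value of `hit` is by definition attained; `coverTime_mono`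
relies on this on all trajectories. -/
lemma hit_eq_coe {ε : ℝ} {ω : Ω} {s : ℝ≥0} (h : hit ε z ω = s) : IsLeast {s | ε ≤ |z s ω|} s := by
  unfold hit at h
  split_ifs at h with h1
  · rw [← WithTop.coe_inj.1 h]
    exact h1.choose_spec
  · exact absurd h.symm WithTop.coe_ne_top

lemma hit_of_isLeast {ε : ℝ} {ω : Ω} {s : ℝ≥0} (h : IsLeast {s | ε ≤ |z s ω|} s) :
    hit ε z ω = s := by
  unfold hit
  have h1 : ∃ s : ℝ≥0, IsLeast {s | ε ≤ |z s ω|} s := ⟨s, h⟩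
  rw [dif_pos h1, WithTop.coe_inj]
  exact h1.choose_spec.unique h

lemma exists_of_hit_le {ε : ℝ} {ω : Ω} {t : ℝ≥0} (h : hit ε z ω ≤ t) : ∃ s ≤ t, ε ≤ |z s ω| := by
  obtain ⟨s, hs⟩ := WithTop.ne_top_iff_exists.1 (ne_top_of_le_ne_top WithTop.coe_ne_top h)
  rw [← hs, WithTop.coe_le_coe] at h
  exact ⟨s, h, (hit_eq_coe hs.symm).1⟩

lemma hit_le_of_continuousOn {ε : ℝ} {ω : Ω} {t : ℝ≥0}
    (hc : ContinuousOn (fun s => z s ω) (Set.Iic t)) {r : ℝ≥0} (hr : r ≤ t) (h : ε ≤ |z r ω|) :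
    hit ε z ω ≤ r := by
  have hK : IsCompact (Set.Iic t ∩ {s | ε ≤ |z s ω|}) := by
    have h1 : IsClosed (Set.Iic t ∩ (fun s => |z s ω|) ⁻¹' Set.Ici ε) :=
      hc.abs.preimage_isClosed_of_isClosed isClosed_Iic isClosed_Ici
    have h2 : IsCompact (Set.Iic t) := by rw [← Set.Icc_bot]; exact isCompact_Icc
    exact h2.of_isClosed_subset h1 Set.inter_subset_left
  obtain ⟨s, hs⟩ := hK.exists_isLeast ⟨r, hr, h⟩
  have h3 : IsLeast {s | ε ≤ |z s ω|} s := by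
    refine ⟨hs.1.2, fun u hu => ?_⟩
    rcases le_total u t with h4 | h4
    · exact hs.2 ⟨h4, hu⟩
    · exact (Set.mem_Iic.1 hs.1.1).trans h4
  rw [hit_of_isLeast h3, WithTop.coe_le_coe]
  exact hs.2 ⟨hr, h⟩

lemma lt_hit {ε : ℝ} {ω : Ω} {t : ℝ≥0} (h : ∀ s ≤ t, |z s ω| < ε) :
    (t : WithTop ℝ≥0) < hit ε z ω := by
  by_contra h1
  obtain ⟨s, hs, h2⟩ := exists_of_hit_le (le_of_not_gt h1)
  exact absurd (h s hs) h2.not_gt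

/-- A value beyond `ε` would, by the intermediate value theorem, be preceded by a time with value
exactly `ε`, hence by the hitting time. -/
lemma abs_le_of_le_hit {ε : ℝ} (hε : 0 < ε) {ω : Ω} {t : ℝ≥0}
    (hc : ContinuousOn (fun s => z s ω) (Set.Iic t)) (h0 : z 0 ω = 0)
    (ht : (t : WithTop ℝ≥0) ≤ hit ε z ω) : |z t ω| ≤ ε := by
  by_contra h
  push Not at h
  have h1 : ContinuousOn (fun s => |z s ω|) (Set.Icc 0 t) :=
    hc.abs.mono fun s hs => hs.2
  obtain ⟨s, hs, hs'⟩ := intermediate_value_Icc (zero_le (a := t)) h1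
    (show ε ∈ Set.Icc |z 0 ω| |z t ω| from ⟨by simpa [h0] using hε.le, h.le⟩)
  dsimp only at hs'
  have h2 := hit_le_of_continuousOn hc hs.2 hs'.ge
  have h3 : t ≤ s := WithTop.coe_le_coe.1 (ht.trans h2)
  have h4 : t = s := le_antisymm h3 hs.2
  rw [← h4] at hs'
  exact h.ne' hs'

/-- Expresses reaching a closed set through countably many times. The slack `1 / (k + 1)` makes the
condition open, so that a dense sequence sees it; compactness of `[0, t]` removes the slack, and
`hyt` makes dense times beyond `t` harmless. -/
lemma exists_le_abs_iff {y : ℝ≥0 → ℝ} (hy : Continuous y) {t : ℝ≥0} (hyt : ∀ r, y r = y (min r t))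
    (ε : ℝ) : (∃ s ≤ t, ε ≤ |y s|) ↔
      ∀ k : ℕ, ∃ n : ℕ, ε - 1 / (k + 1) < |y (TopologicalSpace.denseSeq ℝ≥0 n)| := by
  constructor
  · rintro ⟨s, -, hs⟩ k
    have h1 : IsOpen {r | ε - 1 / (k + 1) < |y r|} := isOpen_lt continuous_const hy.abs
    have h2 : ε - 1 / ((k : ℝ) + 1) < |y s| := by
      have : 0 < 1 / ((k : ℝ) + 1) := by positivity
      linarith
    obtain ⟨n, hn⟩ := (TopologicalSpace.denseRange_denseSeq ℝ≥0).exists_mem_open h1 ⟨s, h2⟩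
    exact ⟨n, hn⟩
  · intro h
    have h2 : IsCompact (Set.Iic t) := by rw [← Set.Icc_bot]; exact isCompact_Icc
    obtain ⟨s, hs, hmax⟩ := h2.exists_isMaxOn ⟨0, Set.mem_Iic.2 zero_le⟩ hy.abs.continuousOn
    refine ⟨s, hs, le_of_forall_pos_lt_add fun η hη => ?_⟩
    obtain ⟨k, hk⟩ := exists_nat_one_div_lt hη
    obtain ⟨n, hn⟩ := h k
    rw [hyt] at hn
    have h3 : |y (min (TopologicalSpace.denseSeq ℝ≥0 n) t)| ≤ |y s| :=
      hmax (Set.mem_Iic.2 (min_le_right _ _))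
    linarith

/-- Right-continuity of the filtration is not needed, since the target set is closed: off the
trajectories leaving `E`, a hit by time `t` is decided by the path on `[0, t]`. -/
lemma IsRegular.isStoppingTime_hit (hA : 𝔐.AssumptionA) (hE : 𝔐.Enforceable E)
    (hz : 𝔐.IsRegular E z) (ε : ℝ) : IsStoppingTime 𝔐.filt (hit ε z) := by
  intro t
  have h1 : MeasurableSet[𝔐.filt t] {ω | ∀ k : ℕ, ∃ n : ℕ,
      ε - 1 / (k + 1) < |killed E t z (TopologicalSpace.denseSeq ℝ≥0 n) ω|} := by
    rw [Set.ofPred_forall]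
    refine MeasurableSet.iInter fun k => ?_
    rw [Set.ofPred_exists]
    refine MeasurableSet.iUnion fun n => ?_
    have h2 := measurable_killed hA hE hz t (TopologicalSpace.denseSeq ℝ≥0 n)
    exact measurableSet_lt measurable_const (continuous_abs.measurable.comp h2)
  refine hA.measurableSet_congr hE h1 fun ω hω => ?_
  have h3 : ∀ r, killed E t z r ω = killed E t z (min r t) ω := fun r => by
    simp only [killed, min_assoc, min_self]
  rw [Set.mem_ofPred_eq, Set.mem_ofPred_eq, ← exists_le_abs_iff (continuous_killed hz t ω) h3]
  have hc := hz.continuousOn t ω (hω t le_rfl)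
  constructor
  · intro h
    obtain ⟨s, hs, h4⟩ := exists_of_hit_le h
    exact ⟨s, hs, by rwa [killed_of_le hs hω]⟩
  · rintro ⟨s, hs, h4⟩
    rw [killed_of_le hs hω] at h4
    exact (hit_le_of_continuousOn hc hs h4).trans (WithTop.coe_le_coe.2 hs)

end Regular

/-! ### Martingales are real and continuous w.i.e. -/

/-- In `EReal` a difference with an infinite term, even `⊤ - ⊤ = ⊥`, has absolute value `∞`; a
finite distance therefore forces both values to be real. -/
lemma real_of_uniformDist_lt {Y Z : ℝ≥0 → Ω → EReal} {t : ℝ≥0} {ω : Ω} {ε : ℝ}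
    (h : uniformDist Y Z (t : WithTop ℝ≥0) ω < ENNReal.ofReal ε) {s : ℝ≥0} (hs : s ≤ t) :
    Y s ω = ((Y s ω).toReal : EReal) ∧ Z s ω = ((Z s ω).toReal : EReal) ∧
      |(Y s ω).toReal - (Z s ω).toReal| < ε := by
  have h1 : (Y s ω - Z s ω).abs < ENNReal.ofReal ε :=
    (le_iSup₂ (f := fun (s : ℝ≥0) (_ : (s : WithTop ℝ≥0) ≤ t) => (Y s ω - Z s ω).abs) s
      (WithTop.coe_le_coe.2 hs)).trans_lt h
  generalize Y s ω = y at *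
  generalize Z s ω = z at *
  induction y with
  | bot => exact absurd h1 (by simp)
  | top => induction z <;> exact absurd h1 (by simp)
  | coe y =>
  induction z with
  | bot => exact absurd h1 (by simp)
  | top => exact absurd h1 (by simp)
  | coe z =>
  refine ⟨by simp, by simp, ?_⟩
  rw [← EReal.coe_sub, EReal.abs_def] at h1
  exact (ENNReal.ofReal_lt_ofReal_iff_of_nonneg (abs_nonneg _)).1 h1

lemma eventually_of_tendsto_uniformDist {Y : ℕ → ℝ≥0 → Ω → EReal} {Z : ℝ≥0 → Ω → EReal}
    {t : ℝ≥0} {ω : Ω} (h : Tendsto (fun n => uniformDist (Y n) Z (t : WithTop ℝ≥0) ω) atTop (𝓝 0))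
    {ε : ℝ} (hε : 0 < ε) : ∀ᶠ n in atTop, ∀ s ≤ t, Y n s ω = ((Y n s ω).toReal : EReal) ∧
      Z s ω = ((Z s ω).toReal : EReal) ∧ |(Y n s ω).toReal - (Z s ω).toReal| < ε := by
  filter_upwards [h.eventually_lt_const (ENNReal.ofReal_pos.2 hε)] with n hn s hs
  exact real_of_uniformDist_lt hn hs

lemma continuousOn_of_eventually {y : ℕ → ℝ≥0 → ℝ} {z : ℝ≥0 → ℝ} {t : ℝ≥0}
    (h : ∀ ε > 0, ∀ᶠ n in atTop, ∀ s ≤ t, |y n s - z s| < ε)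
    (hc : ∀ n, ContinuousOn (y n) (Set.Iic t)) : ContinuousOn z (Set.Iic t) := by
  have h1 : TendstoUniformlyOn y z atTop (Set.Iic t) := by
    rw [Metric.tendstoUniformlyOn_iff]
    intro ε hε
    filter_upwards [h ε hε] with n hn s hs
    rw [dist_comm, Real.dist_eq]
    exact hn s hs
  exact h1.continuousOn (Eventually.of_forall hc).frequently

lemma isRegular_S (𝔐 : MartingaleSpace Ω d) (j : Fin d) : 𝔐.IsRegular Set.univ (𝔐.S j) :=
  ⟨𝔐.measurable_S j, fun _ ω _ => (𝔐.continuous_S j ω).continuousOn⟩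

lemma SimpleStrategy.isRegular_integral (hd : 0 < d) (hA : 𝔐.AssumptionA) (G : 𝔐.SimpleStrategy)
    (j : Fin d) : 𝔐.IsRegular Set.univ (G.integral (𝔐.S j)) := by
  have hreg := fun n => (isRegular_S 𝔐 j).stopped hA (enforceable_univ hd 𝔐)
    (G.isProper.isStoppingTime n)
  refine ⟨fun t => ?_, fun t ω _ => ?_⟩
  · have h1 : ∀ N : ℕ, Measurable[𝔐.filt t] fun ω => G.c + ∑ n ∈ Finset.range N, G.g n ω *
      (𝔐.S j (clock t (G.τ (n + 1) ω)) ω - 𝔐.S j (clock t (G.τ n ω)) ω) := by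
      intro N
      refine measurable_const.add (Finset.measurable_sum _ fun n _ => ?_)
      refine IsKnownAt.measurable_mul (τ := G.τ n) ⟨G.bounded_g n, fun _ => G.measurable_g n⟩
        (G.isProper.isStoppingTime n) (((hreg (n + 1)).measurable t).sub ((hreg n).measurable t))
        fun ω hω => ?_
      rw [clock_of_le hω.le, clock_of_le (hω.le.trans (G.isProper.mono n ω)), sub_self]
    -- The number of relevant terms depends on `ω`, so measurability comes from a pointwise limit of
    -- eventually constant partial sums.
    refine @measurable_of_tendsto_metrizable Ω ℝ (𝔐.filt t) _ _ _ _ _ _ h1 ?_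
    rw [tendsto_pi_nhds]
    intro ω
    obtain ⟨N, hN, -⟩ := G.isProper.exists_clock_eq t ω
    refine tendsto_const_nhds.congr' ?_
    filter_upwards [eventually_ge_atTop N] with k hk
    refine integral_eq_sum G _ fun n hn => ?_
    rw [hN t le_rfl n (hk.trans hn), hN t le_rfl k hk]
  · obtain ⟨N, hN, -⟩ := G.isProper.exists_clock_eq t ω
    have h2 : ContinuousOn (fun s => G.c + ∑ n ∈ Finset.range N, G.g n ω *
        (𝔐.S j (clock s (G.τ (n + 1) ω)) ω - 𝔐.S j (clock s (G.τ n ω)) ω)) (Set.Iic t) :=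
      continuousOn_const.add (continuousOn_finsetSum _ fun n _ => continuousOn_const.mul
        (((hreg (n + 1)).continuousOn t ω (Set.mem_univ _)).sub
          ((hreg n).continuousOn t ω (Set.mem_univ _))))
    exact h2.congr fun s hs => integral_eq_sum G _ (hN s hs)

lemma IsSimpleCapital.isRegular (hd : 0 < d) (hA : 𝔐.AssumptionA) {V : ℝ≥0 → Ω → ℝ}
    (h : 𝔐.IsSimpleCapital V) : 𝔐.IsRegular Set.univ V := by
  obtain ⟨G, hG⟩ := h
  have hreg := fun j => (G j).isRegular_integral hd hA j
  have hV : V = fun t ω => ∑ j, (G j).integral (𝔐.S j) t ω := by ext t ω; exact hG t ω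
  subst hV
  exact ⟨fun t => Finset.measurable_sum _ fun j _ => (hreg j).measurable t, fun t ω hω =>
    continuousOn_finsetSum _ fun j _ => (hreg j).continuousOn t ω hω⟩

/-- On `E` the process `X` is real up to the current time, with continuous trajectories. -/
structure IsRealRegular (𝔐 : MartingaleSpace Ω d) (E : Set (ℝ≥0 × Ω)) (X : ℝ≥0 → Ω → EReal) :
    Prop where
  isRegular : 𝔐.IsRegular E fun t ω => (X t ω).toReal
  coe_toReal : ∀ t ω, (t, ω) ∈ E → ∀ s ≤ t, X s ω = ((X s ω).toReal : EReal)

lemma IsAdapted.measurable_toReal {X : ℝ≥0 → Ω → EReal} (h : 𝔐.IsAdapted X) (t : ℝ≥0) :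
    Measurable[𝔐.filt t] fun ω => (X t ω).toReal :=
  measurable_ereal_toReal.comp (h t)

/-- Continuity on `[0, t]` passes to uniform limits, and the countably many exceptional sets are
merged by `Enforceable.iInter`. -/
lemma IsMartingale.exists_isRealRegular (hd : 0 < d) (hA : 𝔐.AssumptionA) {X : ℝ≥0 → Ω → EReal}
    (hX : 𝔐.IsMartingale X) : ∃ E, 𝔐.Enforceable E ∧ 𝔐.IsRealRegular E X := by
  induction hX with
  | simple V hV =>
    exact ⟨Set.univ, enforceable_univ hd 𝔐, by simpa using hV.isRegular hd hA, by simp⟩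
  | lim Xn X hXn hX hreal hlim ih =>
    choose E hE hreg using ih
    refine ⟨_, hlim.inter hd (Enforceable.iInter hd hE),
      ⟨hX.measurable_toReal, fun t ω hω => ?_⟩, fun t ω hω s hs => ?_⟩
    · refine continuousOn_of_eventually (y := fun n s => (Xn n s ω).toReal) (fun ε hε => ?_)
        fun n => (hreg n).isRegular.continuousOn t ω (Set.mem_iInter.1 hω.2 n)
      filter_upwards [eventually_of_tendsto_uniformDist hω.1 hε] with n hn s hs
      exact (hn s hs).2.2
    · obtain ⟨n, hn⟩ := (eventually_of_tendsto_uniformDist hω.1 one_pos).exists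
      exact (hn s hs).2.1

/-! ### Step integrals of martingales -/

lemma stepIntegral_zero (τ : ℕ → Ω → WithTop ℝ≥0) (f : ℕ → Ω → ℝ) (k : ℕ) (T : Ω → WithTop ℝ≥0)
    (x : ℝ≥0 → Ω → ℝ) (ω : Ω) : stepIntegral τ f k T x 0 ω = 0 := by
  simp [stepIntegral, zero_clock]

lemma stepIntegral_stopped (τ : ℕ → Ω → WithTop ℝ≥0) (f : ℕ → Ω → ℝ) (k : ℕ)
    (T T' : Ω → WithTop ℝ≥0) (x : ℝ≥0 → Ω → ℝ) (t : ℝ≥0) (ω : Ω) :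
    stepIntegral τ f k (fun ω => min (T' ω) (T ω)) x t ω =
      stepIntegral τ f k T x (clock t (T' ω)) ω := by
  simp only [stepIntegral, clock_clock, min_assoc]

/-- Each increment changes by at most twice the uniform distance, whence the factor `2 ∑ |f_l|`; the
`+ 1` keeps the denominator positive and the final inequality strict. -/
lemma abs_stepIntegral_sub_lt (τ : ℕ → Ω → WithTop ℝ≥0) (f : ℕ → Ω → ℝ) (k : ℕ)
    (T : Ω → WithTop ℝ≥0) {x y : ℝ≥0 → Ω → ℝ} {t : ℝ≥0} {ω : Ω} {ε : ℝ} (hε : 0 < ε)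
    (h : ∀ s ≤ t, |x s ω - y s ω| < ε / (2 * ∑ l ∈ Finset.range k, |f l ω| + 1)) :
    ∀ s ≤ t, |stepIntegral τ f k T x s ω - stepIntegral τ f k T y s ω| < ε := by
  intro s hs
  set K := ∑ l ∈ Finset.range k, |f l ω| with hK
  have hK0 : 0 ≤ K := Finset.sum_nonneg fun l _ => abs_nonneg _
  set η := ε / (2 * K + 1) with hη
  have hη0 : 0 < η := by positivity
  unfold stepIntegral
  rw [← Finset.sum_sub_distrib]
  have h1 : ∀ l ∈ Finset.range k, |f l ω *
      (x (clock s (min (T ω) (τ (l + 1) ω))) ω - x (clock s (min (T ω) (τ l ω))) ω) - f l ω *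
      (y (clock s (min (T ω) (τ (l + 1) ω))) ω - y (clock s (min (T ω) (τ l ω))) ω)| ≤
      |f l ω| * (2 * η) := by
    intro l _
    rw [← mul_sub, abs_mul]
    refine mul_le_mul_of_nonneg_left ?_ (abs_nonneg _)
    have h2 := abs_lt.1 (h _ ((clock_le s (min (T ω) (τ (l + 1) ω))).trans hs))
    have h3 := abs_lt.1 (h _ ((clock_le s (min (T ω) (τ l ω))).trans hs))
    rw [abs_le]
    constructor <;> linarith
  calc _ ≤ _ := Finset.abs_sum_le_sum_abs _ _
    _ ≤ _ := Finset.sum_le_sum h1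
    _ = 2 * K * η := by rw [← Finset.sum_mul]; ring
    _ < (2 * K + 1) * η := by linarith
    _ = ε := by rw [hη]; field_simp

/-- A step integral of a martingale can be added to a nonnegative supermartingale at an arbitrarily
small cost, as long as the sum stays nonnegative. -/
theorem IsMartingale.exists_add_stepIntegral (hd : 0 < d) (hA : 𝔐.AssumptionA)
    {X : ℝ≥0 → Ω → EReal} (hX : 𝔐.IsMartingale X) {τ : ℕ → Ω → WithTop ℝ≥0} {f : ℕ → Ω → ℝ}
    (hf : 𝔐.StepData τ f) (k : ℕ) {T : Ω → WithTop ℝ≥0} (hT : IsStoppingTime 𝔐.filt T)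
    {Y : ℝ≥0 → Ω → EReal} (hY : 𝔐.IsNonnegSupermartingale Y)
    (h0 : ∀ t ω, 0 ≤ Y t ω + (stepIntegral τ f k T (fun t ω => (X t ω).toReal) t ω : ℝ))
    {δ : ℝ} (hδ : 0 < δ) :
    ∃ Y' : ℝ≥0 → Ω → EReal, 𝔐.IsNonnegSupermartingale Y' ∧ (∀ ω, Y' 0 ω ≤ Y 0 ω + (δ : ℝ)) ∧
      ∀ t ω, Y t ω + (stepIntegral τ f k T (fun t ω => (X t ω).toReal) t ω : ℝ) ≤ Y' t ω := by
  -- The limit case invokes the induction hypothesis with an earlier stopping time, an enlarged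
  -- supermartingale and the cost `δ / 4`.
  induction hX generalizing T Y δ with
  | simple V hV =>
    simp only [EReal.toReal_coe] at h0 ⊢
    refine ⟨_, .add _ _ hY (hV.stepIntegral hf k hT) h0, fun ω => ?_, fun t ω => le_rfl⟩
    rw [stepIntegral_zero]
    exact add_le_add le_rfl (EReal.coe_le_coe_iff.2 hδ.le)
  | lim Xn X hXn hX hreal hlim ih =>
    choose E' hE' hreg' using fun n => (hXn n).exists_isRealRegular hd hA
    obtain ⟨E'', hE'', hreg''⟩ := (IsMartingale.lim Xn X hXn hX hreal hlim).exists_isRealRegular hd hA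
    set E := {p : ℝ≥0 × Ω | Tendsto
      (fun m => uniformDist (Xn m) X (p.1 : WithTop ℝ≥0) p.2) atTop (𝓝 0)} ∩ (⋂ n, E' n) ∩ E''
      with hEdef
    have hE : 𝔐.Enforceable E := (hlim.inter hd (Enforceable.iInter hd hE')).inter hd hE''
    set x : ℝ≥0 → Ω → ℝ := fun t ω => (X t ω).toReal with hx
    set xn : ℕ → ℝ≥0 → Ω → ℝ := fun n t ω => (Xn n t ω).toReal with hxn
    have hxr : 𝔐.IsRegular E x := hreg''.isRegular.mono Set.inter_subset_right
    have hxnr : ∀ n, 𝔐.IsRegular E (xn n) := fun n => (hreg' n).isRegular.mono fun p hp =>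
      Set.mem_iInter.1 hp.1.2 n
    have hconv : ∀ t ω, (t, ω) ∈ E → ∀ η > 0, ∀ᶠ n in atTop, ∀ s ≤ t, |xn n s ω - x s ω| < η := by
      intro t ω hω η hη
      filter_upwards [eventually_of_tendsto_uniformDist hω.1.1 hη] with n hn s hs
      exact (hn s hs).2.2
    set z : ℕ → ℝ≥0 → Ω → ℝ := fun n t ω =>
      stepIntegral τ f k T (xn n) t ω - stepIntegral τ f k T x t ω with hz
    have hzr : ∀ n, 𝔐.IsRegular E (z n) := fun n =>
      (hf.isRegular_stepIntegral hA hE (hxnr n) k hT).sub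
        (hf.isRegular_stepIntegral hA hE hxr k hT)
    have hHit : ∀ n, IsStoppingTime 𝔐.filt (hit (δ / 4) (z n)) := fun n =>
      (hzr n).isStoppingTime_hit hA hE _
    obtain ⟨U, hU, hU0, hUE⟩ := hE.exists_small (δ := δ / 4) (by positivity)
    -- The cash `δ / 4` covers the deviation of the two integrals up to the hitting time, and `U`
    -- covers everything off `E`. Stopped at that time, `Z` stays nonnegative after the step
    -- integral of `X^n` is added.
    set Z : ℝ≥0 → Ω → EReal := fun t ω => Y t ω + (((δ / 4 : ℝ) : EReal) + U t ω) with hZ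
    have hZs : 𝔐.IsNonnegSupermartingale Z :=
      hY.add_process ((IsNonnegSupermartingale.const hd 𝔐 (by positivity)).add_process hU)
    have hZtop : ∀ t ω, (t, ω) ∉ E → Z t ω = ⊤ := by
      intro t ω hω
      simp only [hZ, hUE t ω hω, EReal.coe_add_top]
      exact EReal.add_top_of_ne_bot (hY.ne_bot t ω)
    have hnonneg : ∀ n t ω, 0 ≤ Z (clock t (hit (δ / 4) (z n) ω)) ω +
        (stepIntegral τ f k (fun ω => min (hit (δ / 4) (z n) ω) (T ω)) (xn n) t ω : ℝ) := by
      intro n t ω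
      rw [stepIntegral_stopped]
      have hs := coe_clock_le t (hit (δ / 4) (z n) ω)
      generalize clock t (hit (δ / 4) (z n) ω) = s at *
      by_cases hω : (s, ω) ∈ E
      · have h1 : |z n s ω| ≤ δ / 4 := abs_le_of_le_hit (by positivity)
          ((hzr n).continuousOn s ω hω) (by simp [hz, stepIntegral_zero]) hs
        have h2 : stepIntegral τ f k T x s ω ≤ δ / 4 + stepIntegral τ f k T (xn n) s ω := by
          have := (abs_le.1 h1).1
          simp only [hz] at this
          linarith
        refine (h0 s ω).trans ?_
        refine (add_le_add le_rfl (EReal.coe_le_coe_iff.2 h2)).trans ?_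
        rw [EReal.coe_add, ← add_assoc]
        refine add_le_add ?_ le_rfl
        refine add_le_add le_rfl ?_
        exact le_add_of_nonneg_right (hU.nonneg s ω)
      · rw [hZtop s ω hω, EReal.top_add_coe]
        exact le_top
    choose Y' hY' hY'0 hY'le using fun n => ih n ((hHit n).min hT) (hZs.stopped (hHit n))
      (hnonneg n) (show 0 < δ / 4 by positivity)
    -- `U` is added once more because the stopped `Z` may miss a failure of `E` after the hitting
    -- time. The total cost is four times `δ / 4`: cash, `U` twice, and the induction hypothesis.
    refine ⟨_, (IsNonnegSupermartingale.liminf _ hY').add_process hU, fun ω => ?_, fun t ω => ?_⟩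
    · have h1 : ∀ n, Y' n 0 ω ≤ Y 0 ω + ((3 * (δ / 4) : ℝ) : EReal) := fun n => by
        refine (hY'0 n ω).trans (le_of_eq ?_)
        simp only [hZ, zero_clock, hU0]
        rw [add_assoc, ← EReal.coe_add, ← EReal.coe_add]
        congr 2
        ring
      have h2 : Filter.liminf (fun n => Y' n 0 ω) atTop ≤ Y 0 ω + ((3 * (δ / 4) : ℝ) : EReal) :=
        (liminf_le_liminf (Eventually.of_forall h1)).trans (liminf_const _).le
      refine (add_le_add h2 (hU0 ω).le).trans (le_of_eq ?_)
      rw [add_assoc, ← EReal.coe_add]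
      congr 2
      ring
    · by_cases hω : (t, ω) ∈ E
      · refine le_trans ?_ (le_add_of_nonneg_right (hU.nonneg t ω))
        refine le_liminf_of_le (by isBoundedDefault) ?_
        filter_upwards [hconv t ω hω (δ / 4 / (2 * ∑ l ∈ Finset.range k, |f l ω| + 1))
          (by have : 0 ≤ ∑ l ∈ Finset.range k, |f l ω| := Finset.sum_nonneg fun l _ => abs_nonneg _
              positivity)] with n hn
        have h1 := abs_stepIntegral_sub_lt τ f k T (show 0 < δ / 4 by positivity) hn
        -- Uniform convergence on `[0, t]` postpones the hitting time beyond `t` for large `n`, so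
        -- stopping has no effect in the limit.
        have h2 : (t : WithTop ℝ≥0) < hit (δ / 4) (z n) ω := lt_hit h1
        refine le_trans ?_ (hY'le n t ω)
        rw [stepIntegral_stopped, clock_of_le h2.le]
        have h3 : stepIntegral τ f k T x t ω ≤ δ / 4 + stepIntegral τ f k T (xn n) t ω := by
          have := (abs_lt.1 (h1 t le_rfl)).1
          linarith
        refine (add_le_add le_rfl (EReal.coe_le_coe_iff.2 h3)).trans ?_
        rw [EReal.coe_add, ← add_assoc]
        refine add_le_add (add_le_add le_rfl ?_) le_rfl
        exact le_add_of_nonneg_right (hU.nonneg t ω)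
      · rw [hUE t ω hω, EReal.add_top_of_ne_bot]
        · exact le_top
        · exact (IsNonnegSupermartingale.liminf _ hY').ne_bot t ω

/-! ### Covers by successive moves of size `ε` -/

/-- The successive times when `x` has moved by `ε` since the previous such time. -/
noncomputable def coverTime (x : ℝ≥0 → Ω → ℝ) (ε : ℝ) : ℕ → Ω → WithTop ℝ≥0
  | 0 => fun _ => 0
  | n + 1 => hit ε fun t ω => x t ω - x (clock t (coverTime x ε n ω)) ω

section Cover

variable {E : Set (ℝ≥0 × Ω)} {x : ℝ≥0 → Ω → ℝ} {ε : ℝ}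

lemma isStoppingTime_coverTime (hA : 𝔐.AssumptionA) (hE : 𝔐.Enforceable E)
    (hx : 𝔐.IsRegular E x) (n : ℕ) : IsStoppingTime 𝔐.filt (coverTime x ε n) := by
  induction n with
  | zero => exact isStoppingTime_const 𝔐.filt 0
  | succ n ih => exact (hx.sub (hx.stopped hA hE ih)).isStoppingTime_hit hA hE ε

lemma le_abs_of_coverTime_eq {n : ℕ} {ω : Ω} {s : ℝ≥0} (h : coverTime x ε (n + 1) ω = s) :
    ε ≤ |x s ω - x (clock s (coverTime x ε n ω)) ω| := (hit_eq_coe h).1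

lemma coverTime_mono (hε : 0 < ε) (n : ℕ) (ω : Ω) :
    coverTime x ε n ω ≤ coverTime x ε (n + 1) ω := by
  by_contra h
  push Not at h
  obtain ⟨s, hs⟩ := WithTop.ne_top_iff_exists.1 (ne_top_of_lt h)
  have h1 := le_abs_of_coverTime_eq hs.symm
  rw [clock_of_le (hs.trans_lt h).le, sub_self, abs_zero] at h1
  exact h1.not_gt hε

lemma abs_sub_le_of_le_coverTime (hε : 0 < ε) {n : ℕ} {ω : Ω} {s : ℝ≥0}
    (hc : ContinuousOn (fun s => x s ω) (Set.Iic s))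
    (hs : (s : WithTop ℝ≥0) ≤ coverTime x ε (n + 1) ω) :
    |x s ω - x (clock s (coverTime x ε n ω)) ω| ≤ ε := by
  refine abs_le_of_le_hit (z := fun t ω => x t ω - x (clock t (coverTime x ε n ω)) ω) hε ?_ ?_ hs
  · exact hc.sub (hc.comp (continuous_clock _).continuousOn
      fun r hr => Set.mem_Iic.2 ((clock_le _ _).trans hr))
  · simp [zero_clock]

/-- Otherwise the times would increase to a limit in `[0, t]`; continuity there would send the
increments to `0`, while each is at least `ε` in absolute value. -/
lemma exists_lt_coverTime (hε : 0 < ε) {ω : Ω} {t : ℝ≥0}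
    (hc : ContinuousOn (fun s => x s ω) (Set.Iic t)) :
    ∃ N, ∀ n ≥ N, (t : WithTop ℝ≥0) < coverTime x ε n ω := by
  have hmono := mono_of_le_succ (coverTime_mono (x := x) hε) ω
  suffices h : ∃ N, (t : WithTop ℝ≥0) < coverTime x ε N ω from
    h.imp fun N hN n hn => hN.trans_le (hmono hn)
  by_contra h
  push Not at h
  set r : ℕ → ℝ≥0 := fun n => clock t (coverTime x ε n ω) with hr
  have hrm : Monotone r := fun a b hab => clock_mono_right t (hmono hab)
  have hbdd : BddAbove (Set.range r) := ⟨t, by rintro _ ⟨n, rfl⟩; exact clock_le _ _⟩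
  have hlim := tendsto_atTop_ciSup hrm hbdd
  have hL : (⨆ n, r n) ∈ Set.Iic t := Set.mem_Iic.2 (ciSup_le fun n => clock_le _ _)
  have h1 : Tendsto (fun n => x (r n) ω) atTop (𝓝 (x (⨆ n, r n) ω)) :=
    (hc _ hL).tendsto.comp (tendsto_nhdsWithin_iff.2
      ⟨hlim, Eventually.of_forall fun n => Set.mem_Iic.2 (clock_le _ _)⟩)
  have h2 : Tendsto (fun n => |x (r (n + 1)) ω - x (r n) ω|) atTop (𝓝 0) := by
    have := ((h1.comp (tendsto_add_atTop_nat 1)).sub h1).abs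
    simpa using this
  obtain ⟨n, hn⟩ := (h2.eventually_lt_const hε).exists
  have h3 : coverTime x ε (n + 1) ω = r (n + 1) := (coe_clock_of_ge (h _)).symm
  have h4 := le_abs_of_coverTime_eq h3
  rw [show clock (r (n + 1)) (coverTime x ε n ω) = r n by
    rw [hr, clock_clock, min_eq_right (coverTime_mono hε n ω)]] at h4
  exact h4.not_gt hn

lemma abs_sub_start_le (hε : 0 < ε) {ω : Ω} {t : ℝ≥0}
    (hc : ContinuousOn (fun s => x s ω) (Set.Iic t)) (n : ℕ) :
    |x (clock t (coverTime x ε n ω)) ω - x 0 ω| ≤ n * ε := by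
  induction n with
  | zero => simp [coverTime, clock_zero]
  | succ n ih =>
    have h1 := abs_sub_le_of_le_coverTime hε (n := n)
      (hc.mono (Set.Iic_subset_Iic.2 (clock_le t (coverTime x ε (n + 1) ω)))) (coe_clock_le _ _)
    rw [clock_clock, min_eq_right (coverTime_mono hε n ω)] at h1
    calc _ ≤ _ := abs_sub_le _ (x (clock t (coverTime x ε n ω)) ω) _
      _ ≤ _ := add_le_add h1 ih
      _ = _ := by push_cast; ring

/-- Every value on a cover interval is within `ε` of the value at its left end, so the oscillation
is at most `2 * ε`. -/
lemma isFineCoverOn_coverTime (hA : 𝔐.AssumptionA) (hE : 𝔐.Enforceable E)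
    {X : ℝ≥0 → Ω → EReal} (hX : 𝔐.IsRealRegular E X) (hε : 0 < ε) :
    𝔐.IsFineCoverOn X (2 * ε) (coverTime (fun t ω => (X t ω).toReal) ε) E where
  isStoppingTime := isStoppingTime_coverTime hA hE hX.isRegular
  mono := coverTime_mono hε
  zero _ := rfl
  finite t ω hω := by
    obtain ⟨N, hN⟩ := exists_lt_coverTime (x := fun t ω => (X t ω).toReal) hε
      (hX.isRegular.continuousOn t ω hω)
    refine (Set.finite_Iio N).subset fun n hn => ?_
    by_contra h
    exact (hN n (not_lt.1 h)).not_ge hn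
  osc n t ω hω := by
    set x : ℝ≥0 → Ω → ℝ := fun t ω => (X t ω).toReal with hx
    have hc : ContinuousOn (fun s => x s ω) (Set.Iic t) := hX.isRegular.continuousOn t ω hω
    set a := x (clock t (coverTime x ε n ω)) ω with ha
    have key : ∀ s : ℝ≥0, min (coverTime x ε n ω) t ≤ s ∧
        (s : WithTop ℝ≥0) ≤ min (coverTime x ε (n + 1) ω) t →
        X s ω = (x s ω : EReal) ∧ |x s ω - a| ≤ ε := by
      rintro s ⟨h1, h2⟩
      have hst : s ≤ t := WithTop.coe_le_coe.1 (h2.trans (min_le_right _ _))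
      refine ⟨hX.coe_toReal t ω hω s hst, ?_⟩
      have h3 := abs_sub_le_of_le_coverTime (x := x) hε (n := n) (hc.mono (Set.Iic_subset_Iic.2 hst))
        (h2.trans (min_le_left _ _))
      have h4 : clock s (coverTime x ε n ω) = clock t (coverTime x ε n ω) := by
        rw [← WithTop.coe_inj, coe_clock, coe_clock]
        refine le_antisymm (min_le_min_right _ (WithTop.coe_le_coe.2 hst)) (le_min ?_ ?_)
        · rwa [min_comm]
        · exact min_le_right _ _
      rwa [h4] at h3
    have h1 : sSup ((fun s => X s ω) '' {s : ℝ≥0 | min (coverTime x ε n ω) t ≤ s ∧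
        (s : WithTop ℝ≥0) ≤ min (coverTime x ε (n + 1) ω) t}) ≤ ((a + ε : ℝ) : EReal) := by
      refine sSup_le ?_
      rintro _ ⟨s, hs, rfl⟩
      obtain ⟨h2, h3⟩ := key s hs
      dsimp only
      rw [h2, EReal.coe_le_coe_iff]
      linarith [(abs_le.1 h3).2]
    have h2 : ((a - ε : ℝ) : EReal) ≤ sInf ((fun s => X s ω) '' {s : ℝ≥0 |
        min (coverTime x ε n ω) t ≤ s ∧
        (s : WithTop ℝ≥0) ≤ min (coverTime x ε (n + 1) ω) t}) := by
      refine le_sInf ?_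
      rintro _ ⟨s, hs, rfl⟩
      obtain ⟨h2, h3⟩ := key s hs
      dsimp only
      rw [h2, EReal.coe_le_coe_iff]
      linarith [(abs_le.1 h3).1]
    refine (EReal.sub_le_sub h1 h2).trans ?_
    rw [← EReal.coe_sub, EReal.coe_le_coe_iff]
    linarith

end Cover

/-! ### Simple quadratic variation and the displacement strategy -/

/-- The sum of the first `k` squared increments of `x` along `τ`. -/
noncomputable def partialQV (x : ℝ≥0 → Ω → ℝ) (τ : ℕ → Ω → WithTop ℝ≥0) (k : ℕ) (t : ℝ≥0)
    (ω : Ω) : ℝ :=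
  ∑ n ∈ Finset.range k, (x (clock t (τ (n + 1) ω)) ω - x (clock t (τ n ω)) ω) ^ 2

section QV

variable {E : Set (ℝ≥0 × Ω)} {X : ℝ≥0 → Ω → EReal} {τ : ℕ → Ω → WithTop ℝ≥0}

lemma IsRealRegular.simpleQV_eq_tsum (hX : 𝔐.IsRealRegular E X) {t s : ℝ≥0} {ω : Ω}
    (hω : (t, ω) ∈ E) (hs : s ≤ t) : simpleQV X τ s ω =
      ((∑' n : ℕ, ENNReal.ofReal (((X (clock s (τ (n + 1) ω)) ω).toReal -
        (X (clock s (τ n ω)) ω).toReal) ^ 2) : ℝ≥0∞) : EReal) := by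
  unfold simpleQV
  congr 2
  ext n
  rw [stoppedProcess_apply, stoppedProcess_apply,
    hX.coe_toReal t ω hω _ ((clock_le s (τ (n + 1) ω)).trans hs),
    hX.coe_toReal t ω hω _ ((clock_le s (τ n ω)).trans hs), ← EReal.coe_sub, EReal.abs_def,
    ← ENNReal.ofReal_pow (abs_nonneg _), sq_abs, EReal.toReal_coe, EReal.toReal_coe]

lemma IsRealRegular.simpleQV_eq_partialQV (hX : 𝔐.IsRealRegular E X) {t s : ℝ≥0} {ω : Ω}
    (hω : (t, ω) ∈ E) (hs : s ≤ t) {N : ℕ}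
    (hN : ∀ n ≥ N, (s : WithTop ℝ≥0) ≤ τ n ω) :
    simpleQV X τ s ω = (partialQV (fun t ω => (X t ω).toReal) τ N s ω : EReal) := by
  rw [hX.simpleQV_eq_tsum hω hs, tsum_eq_sum (s := Finset.range N), partialQV,
    ← ENNReal.ofReal_sum_of_nonneg fun _ _ => sq_nonneg _,
    EReal.coe_ennreal_ofReal, max_eq_left (Finset.sum_nonneg fun _ _ => sq_nonneg _)]
  intro n hn
  have hn' : N ≤ n := by simpa using hn
  rw [clock_of_le (hN n hn'), clock_of_le (hN (n + 1) (by lia))]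
  simp

lemma IsRealRegular.simpleQV_zero (hX : 𝔐.IsRealRegular E X) {ω : Ω} (hω : (0, ω) ∈ E) :
    simpleQV X τ 0 ω = 0 := by
  rw [hX.simpleQV_eq_tsum hω le_rfl]
  simp [zero_clock]

lemma IsRealRegular.isRegular_simpleQV (hA : 𝔐.AssumptionA) (hE : 𝔐.Enforceable E)
    (hX : 𝔐.IsRealRegular E X) (hτ : ∀ n, IsStoppingTime 𝔐.filt (τ n))
    (hfin : ∀ t ω, (t, ω) ∈ E → ∃ N, ∀ n ≥ N, (t : WithTop ℝ≥0) < τ n ω) :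
    𝔐.IsRegular E fun t ω => (simpleQV X τ t ω).toReal := by
  have hr := fun n => hX.isRegular.stopped hA hE (hτ n)
  refine ⟨fun t => ?_, fun t ω hω => ?_⟩
  · refine hA.measurable_congr hE (f' := fun ω => (∑' n : ℕ, ENNReal.ofReal
      (((X (clock t (τ (n + 1) ω)) ω).toReal - (X (clock t (τ n ω)) ω).toReal) ^ 2)).toReal) ?_
      fun ω hω => ?_
    · simp_rw [ENNReal.tsum_eq_iSup_nat]
      refine ENNReal.measurable_toReal.comp (Measurable.iSup fun N =>
        Finset.measurable_sum _ fun n _ => ?_)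
      exact ENNReal.measurable_ofReal.comp
        ((((hr (n + 1)).measurable t).sub ((hr n).measurable t)).pow_const 2)
    · rw [hX.simpleQV_eq_tsum (hω t le_rfl) le_rfl, EReal.toReal_coe_ennreal]
  · obtain ⟨N, hN⟩ := hfin t ω hω
    have h1 : ContinuousOn (fun s => partialQV (fun t ω => (X t ω).toReal) τ N s ω) (Set.Iic t) :=
      continuousOn_finsetSum _ fun n _ =>
        (((hr (n + 1)).continuousOn t ω hω).sub ((hr n).continuousOn t ω hω)).pow 2
    refine h1.congr fun s hs => ?_
    dsimp only
    rw [hX.simpleQV_eq_partialQV hω hs fun n hn =>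
      (WithTop.coe_le_coe.2 hs).trans (hN n hn).le, EReal.toReal_coe]

/-- The position `a (x_{τ_n} - x_0)`, truncated at the level `a n ε`. -/
noncomputable def displacement (a ε : ℝ) (x : ℝ≥0 → Ω → ℝ) (τ : ℕ → Ω → WithTop ℝ≥0) (n : ℕ)
    (ω : Ω) : ℝ :=
  if τ n ω = ⊤ then 0
  else a * max (-(n * ε)) (min (n * ε) (x (τ n ω).untopA ω - x 0 ω))

/-- Positions must be bounded on all of `Ω`, while the displacement is controlled only on regular
trajectories: hence the truncation, which `abs_sub_start_le` shows to be inactive on those. -/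
lemma isKnownAt_displacement (hA : 𝔐.AssumptionA) (hE : 𝔐.Enforceable E) {x : ℝ≥0 → Ω → ℝ}
    (hx : 𝔐.IsRegular E x) (hτ : ∀ n, IsStoppingTime 𝔐.filt (τ n)) {ε : ℝ} (hε : 0 < ε) (a : ℝ)
    (n : ℕ) : 𝔐.IsKnownAt (τ n) (displacement a ε x τ n) := by
  have hn : 0 ≤ n * ε := by positivity
  refine ⟨⟨|a| * (n * ε), fun ω => ?_⟩, fun h A hA' => ?_⟩
  · unfold displacement
    split_ifs
    · simp only [abs_zero]; positivity
    · rw [abs_mul]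
      refine mul_le_mul_of_nonneg_left (abs_le.2 ⟨le_max_left _ _, ?_⟩) (abs_nonneg _)
      exact max_le (by linarith) (min_le_left _ _)
  · have key : ∀ t : ℝ≥0, MeasurableSet[𝔐.filt t] (displacement a ε x τ n ⁻¹' A ∩ {ω | τ n ω ≤ t}) := by
      intro t
      have h1 : Measurable[𝔐.filt t] fun ω =>
          a * max (-(n * ε)) (min (n * ε) (x (clock t (τ n ω)) ω - x 0 ω)) :=
        measurable_const.mul (measurable_const.max (measurable_const.min
          ((hx.measurable_stopped hA hE (hτ n) t).sub
            ((hx.measurable 0).mono (𝔐.filt.mono (zero_le)) le_rfl))))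
      convert (h1 hA').inter (hτ n t) using 1
      ext ω
      refine and_congr_left fun hω => ?_
      have hω' : τ n ω ≤ t := hω
      have h2 : τ n ω ≠ ⊤ := ne_top_of_le_ne_top WithTop.coe_ne_top hω'
      have h3 : (τ n ω).untopA = clock t (τ n ω) := by rw [clock, min_eq_right hω']
      simp only [Set.mem_preimage, displacement, if_neg h2, h3]
    rw [h.measurableSet]
    refine ⟨?_, key⟩
    -- The σ-field at a stopping time also demands measurability with respect to the supremum of the
    -- filtration; the preimage is split into the parts with `τ_n ≤ k` and the part with `τ_n = ∞`,
    -- where the position is `0`.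
    have h4 : displacement a ε x τ n ⁻¹' A =
        (⋃ k : ℕ, displacement a ε x τ n ⁻¹' A ∩ {ω | τ n ω ≤ ((k : ℝ≥0) : WithTop ℝ≥0)}) ∪
          ({ω | τ n ω = ⊤} ∩ {_ω : Ω | (0 : ℝ) ∈ A}) := by
      ext ω
      by_cases hω : τ n ω = ⊤
      · simp [hω, displacement]
      · obtain ⟨s, hs⟩ := WithTop.ne_top_iff_exists.1 hω
        obtain ⟨k, hk⟩ := exists_nat_ge s
        have : ∃ k : ℕ, τ n ω ≤ ((k : ℝ≥0) : WithTop ℝ≥0) :=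
          ⟨k, by rw [← hs]; exact WithTop.coe_le_coe.2 hk⟩
        simp only [Set.mem_union, Set.mem_iUnion, Set.mem_inter_iff, Set.mem_ofPred_eq, hω,
          false_and, or_false, exists_and_left, this, and_true]
    rw [h4]
    have h5 : ∀ t, 𝔐.filt t ≤ ⨆ t, 𝔐.filt t := fun t => le_iSup (fun t => 𝔐.filt t) t
    refine (MeasurableSet.iUnion fun k : ℕ => h5 _ _ (key k)).union
      (MeasurableSet.inter ?_ (MeasurableSet.const _))
    exact h.measurableSet_eq_top'

end QV

/-! ### Transfer of domination -/

section Transfer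

variable {E : Set (ℝ≥0 × Ω)} {X : ℝ≥0 → Ω → EReal}

lemma isStoppingTime_top (𝔐 : MartingaleSpace Ω d) :
    IsStoppingTime 𝔐.filt (fun _ : Ω => (⊤ : WithTop ℝ≥0)) := fun i => by
  simp

/-- A nonnegative process `p'` that differs from `p` by a step integral of a martingale, up to times
`τ_k → ∞`, is dominated at the cost of dominating `p`. -/
lemma IsMartingale.exists_dominating (hd : 0 < d) (hA : 𝔐.AssumptionA) (hX : 𝔐.IsMartingale X)
    (hE : 𝔐.Enforceable E) {τ : ℕ → Ω → WithTop ℝ≥0} {f : ℕ → Ω → ℝ} (hf : 𝔐.StepData τ f)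
    (hfin : ∀ t ω, (t, ω) ∈ E → ∃ N, ∀ n ≥ N, (t : WithTop ℝ≥0) < τ n ω)
    {p p' : ℝ≥0 → Ω → ℝ} (hp' : ∀ t ω, 0 ≤ p' t ω)
    (hpp' : ∀ (t : ℝ≥0) ω k, (t, ω) ∈ E → (t : WithTop ℝ≥0) ≤ τ k ω →
      p' t ω = p t ω + stepIntegral τ f k (fun _ => ⊤) (fun t ω => (X t ω).toReal) t ω)
    {T : Ω → WithTop ℝ≥0} (hT : IsStoppingTime 𝔐.filt T) {Y : ℝ≥0 → Ω → EReal}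
    (hY : 𝔐.IsNonnegSupermartingale Y)
    (hpY : ∀ (t : ℝ≥0) ω, (t, ω) ∈ E → (t : WithTop ℝ≥0) ≤ T ω → (p t ω : EReal) ≤ Y t ω)
    {δ : ℝ} (hδ : 0 < δ) :
    ∃ Y' : ℝ≥0 → Ω → EReal, 𝔐.IsNonnegSupermartingale Y' ∧ (∀ ω, Y' 0 ω ≤ Y 0 ω + (δ : ℝ)) ∧
      ∀ (t : ℝ≥0) ω, (t, ω) ∈ E → (t : WithTop ℝ≥0) ≤ T ω → (p' t ω : EReal) ≤ Y' t ω := by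
  obtain ⟨U, hU, hU0, hUE⟩ := hE.exists_small (δ := δ / 2) (by positivity)
  have hZ := hY.add_process hU
  -- Stopping at `τ_k` keeps the `k`-term identity for `p'` valid, hence the sum nonnegative;
  -- letting `k → ∞` in the `liminf` removes this restriction on `E`.
  have hR := fun k => hT.min (hf.isStoppingTime k)
  have hle : ∀ (t : ℝ≥0) ω k, (t, ω) ∈ E → (t : WithTop ℝ≥0) ≤ T ω → (t : WithTop ℝ≥0) ≤ τ k ω →
      (p' t ω : EReal) ≤ Y t ω + U t ω +
        (stepIntegral τ f k (fun _ => ⊤) (fun t ω => (X t ω).toReal) t ω : ℝ) := by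
    intro t ω k hω h1 h2
    rw [hpp' t ω k hω h2, EReal.coe_add]
    exact add_le_add ((hpY t ω hω h1).trans (le_add_of_nonneg_right (hU.nonneg t ω))) le_rfl
  have hnonneg : ∀ k t ω, 0 ≤ Y (clock t (min (T ω) (τ k ω))) ω + U (clock t (min (T ω) (τ k ω))) ω +
      (stepIntegral τ f k (fun ω => min (min (T ω) (τ k ω)) ⊤) (fun t ω => (X t ω).toReal) t ω : ℝ) := by
    intro k t ω
    rw [stepIntegral_stopped τ f k (fun _ => ⊤) (fun ω => min (T ω) (τ k ω))]
    have hs := coe_clock_le t (min (T ω) (τ k ω))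
    generalize clock t (min (T ω) (τ k ω)) = s at *
    by_cases hω : (s, ω) ∈ E
    · exact (EReal.coe_nonneg.2 (hp' s ω)).trans
        (hle s ω k hω (hs.trans (min_le_left _ _)) (hs.trans (min_le_right _ _)))
    · rw [hUE s ω hω, EReal.add_top_of_ne_bot (hY.ne_bot s ω), EReal.top_add_coe]
      exact le_top
  choose Y' hY' hY'0 hY'le using fun k => hX.exists_add_stepIntegral hd hA hf k
    ((hR k).min (isStoppingTime_top 𝔐)) (hZ.stopped (hR k)) (hnonneg k) (half_pos hδ)
  refine ⟨_, .liminf _ hY', fun ω => ?_, fun t ω hω htT => ?_⟩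
  · refine (liminf_le_liminf (v := fun _ => Y 0 ω + (δ : EReal))
      (Eventually.of_forall fun k => (hY'0 k ω).trans (le_of_eq ?_))).trans (liminf_const _).le
    rw [zero_clock, hU0, add_assoc, ← EReal.coe_add, add_halves]
  · refine le_liminf_of_le (by isBoundedDefault) ?_
    obtain ⟨N, hN⟩ := hfin t ω hω
    filter_upwards [eventually_ge_atTop N] with k hk
    refine le_trans ?_ (hY'le k t ω)
    rw [stepIntegral_stopped τ f k (fun _ => ⊤) (fun ω => min (T ω) (τ k ω))]
    rw [clock_of_le (le_min htT (hN k hk).le)]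
    exact hle t ω k hω htT (hN k hk).le

lemma stepData_displacement (hA : 𝔐.AssumptionA) (hE : 𝔐.Enforceable E) {x : ℝ≥0 → Ω → ℝ}
    (hx : 𝔐.IsRegular E x) {ε : ℝ} (hε : 0 < ε) (a : ℝ) :
    𝔐.StepData (coverTime x ε) (displacement a ε x (coverTime x ε)) :=
  ⟨isStoppingTime_coverTime hA hE hx, coverTime_mono hε,
    isKnownAt_displacement hA hE hx (isStoppingTime_coverTime hA hE hx) hε a⟩

/-- Rests on `(c - x_0)² - (b - x_0)² = 2 (b - x_0)(c - b) + (c - b)²` for consecutive values `b`,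
`c`. If `τ_k > t` the increment vanishes; otherwise the truncation is inactive. -/
lemma stepIntegral_displacement {x : ℝ≥0 → Ω → ℝ} {ε : ℝ} (hε : 0 < ε) (a : ℝ) {t : ℝ≥0} {ω : Ω}
    (hc : ContinuousOn (fun s => x s ω) (Set.Iic t)) (k : ℕ) :
    stepIntegral (coverTime x ε) (displacement a ε x (coverTime x ε)) k (fun _ => ⊤) x t ω =
      a / 2 * ((x (clock t (coverTime x ε k ω)) ω - x 0 ω) ^ 2 -
        partialQV x (coverTime x ε) k t ω) := by
  induction k with
  | zero => simp [stepIntegral, partialQV, coverTime, clock_zero]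
  | succ k ih =>
    have h1 : displacement a ε x (coverTime x ε) k ω *
        (x (clock t (coverTime x ε (k + 1) ω)) ω - x (clock t (coverTime x ε k ω)) ω) =
        a * (x (clock t (coverTime x ε k ω)) ω - x 0 ω) *
        (x (clock t (coverTime x ε (k + 1) ω)) ω - x (clock t (coverTime x ε k ω)) ω) := by
      rcases le_or_gt (coverTime x ε k ω) t with h | h
      · congr 1
        have h2 : coverTime x ε k ω ≠ ⊤ := ne_top_of_le_ne_top WithTop.coe_ne_top h
        have h3 : (coverTime x ε k ω).untopA = clock t (coverTime x ε k ω) := by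
          rw [clock, min_eq_right h]
        have h4 := abs_le.1 (abs_sub_start_le hε hc k)
        rw [displacement, if_neg h2, h3, min_eq_right h4.2, max_eq_right h4.1]
      · rw [clock_of_le h.le, clock_of_le (h.le.trans (coverTime_mono hε k ω))]
        simp
    unfold stepIntegral partialQV at *
    rw [Finset.sum_range_succ, Finset.sum_range_succ, ih, min_eq_right le_top, min_eq_right le_top,
      h1]
    ring

lemma IsRealRegular.toReal_simpleQV_coverTime (hX : 𝔐.IsRealRegular E X) {ε : ℝ} {t : ℝ≥0} {ω : Ω}
    (hω : (t, ω) ∈ E) (hε : 0 < ε) {k : ℕ}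
    (hk : (t : WithTop ℝ≥0) ≤ coverTime (fun t ω => (X t ω).toReal) ε k ω) :
    simpleQV X (coverTime (fun t ω => (X t ω).toReal) ε) t ω =
      (partialQV (fun t ω => (X t ω).toReal) (coverTime (fun t ω => (X t ω).toReal) ε) k t ω :
        EReal) :=
  hX.simpleQV_eq_partialQV hω le_rfl fun _ hn =>
    hk.trans (mono_of_le_succ (coverTime_mono hε) ω hn)

end Transfer

/-- Initial values are deterministic (`exists_start`), so each `Y'` competes in the infimum; the
arbitrarily small `ε` absorbs the cost. -/
lemma upperExp_le_upperExp [Nonempty Ω] {F F' : ℝ≥0 → Ω → EReal}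
    (h : ∀ Y, 𝔐.IsNonnegSupermartingale Y → (∀ t ω, F t ω ≤ Y t ω) → ∀ ε : ℝ, 0 < ε →
      ∃ Y', 𝔐.IsNonnegSupermartingale Y' ∧ (∀ ω, Y' 0 ω ≤ Y 0 ω + (ε : ℝ)) ∧
        ∀ t ω, F' t ω ≤ Y' t ω) : 𝔐.upperExp F' ≤ 𝔐.upperExp F := by
  refine le_sInf ?_
  rintro y ⟨Y, hY, hY0, hFY⟩
  inhabit Ω
  rw [← EReal.le_of_forall_lt_iff_le]
  intro z hz
  have hy : 0 ≤ y := (hY.nonneg 0 default).trans (hY0 default).le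
  lift y to ℝ using ⟨hz.ne_top, ne_of_gt (lt_of_lt_of_le EReal.bot_lt_zero hy)⟩
  obtain ⟨Y', hY', hY'0, hF'⟩ := h Y hY hFY (z - y) (sub_pos.2 (EReal.coe_lt_coe_iff.1 hz))
  obtain ⟨y', hy'⟩ := hY'.exists_start
  have h1 : 𝔐.upperExp F' ≤ y' := by
    unfold upperExp
    exact sInf_le ⟨Y', hY', hy', hF'⟩
  refine h1.trans ?_
  rw [← hy' default]
  refine (hY'0 default).trans ?_
  rw [hY0, ← EReal.coe_add]
  simp

end MartingaleSpace

/-! ### The isometry -/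

open MartingaleSpace in
theorem fact1011 {Ω : Type*} [MeasurableSpace Ω] [Nonempty Ω] {d : ℕ} (hd : 0 < d)
    (𝔐 : MartingaleSpace Ω d) (hA : 𝔐.AssumptionA)
    (X : ℝ≥0 → Ω → EReal) (hX : 𝔐.IsMartingale X)
    (Q : ℝ≥0 → Ω → EReal) (hQ : 𝔐.IsQuadraticVariation X Q) :
    𝔐.upperExp (fun t ω => (X t ω - X 0 ω) ^ 2) = 𝔐.upperExp Q := by
  obtain ⟨E₀, hE₀, hX₀⟩ := hX.exists_isRealRegular hd hA
  set x : ℝ≥0 → Ω → ℝ := fun t ω => (X t ω).toReal with hx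
  set ε : ℕ → ℝ := fun n => (1 / 2) ^ n with hεdef
  have hε : ∀ n, 0 < ε n := fun n => by positivity
  set τ : ℕ → ℕ → Ω → WithTop ℝ≥0 := fun n => coverTime x (ε n) with hτ
  have hconv := (hQ.tendsto (fun n => 2 * ε n) τ (fun n => by have := hε n; positivity)
    (summable_geometric_two.mul_left 2)
    fun n => ⟨E₀, hE₀, isFineCoverOn_coverTime hA hE₀ hX₀ (hε n)⟩).2
  set E := E₀ ∩ {p | Tendsto (fun n => uniformDist (simpleQV X (τ n)) Q (p.1 : WithTop ℝ≥0) p.2)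
    atTop (𝓝 0)} with hEdef
  have hE : 𝔐.Enforceable E := hE₀.inter hd hconv
  have hXE : 𝔐.IsRealRegular E X :=
    ⟨hX₀.isRegular.mono Set.inter_subset_left, fun t ω hω => hX₀.coe_toReal t ω hω.1⟩
  have hxE : 𝔐.IsRegular E x := hXE.isRegular
  have hfin : ∀ n t ω, (t, ω) ∈ E → ∃ N, ∀ k ≥ N, (t : WithTop ℝ≥0) < τ n k ω :=
    fun n t ω hω => exists_lt_coverTime (hε n) (hxE.continuousOn t ω hω)
  have hsq : ∀ t ω, (t, ω) ∈ E → (X t ω - X 0 ω) ^ 2 = (((x t ω - x 0 ω) ^ 2 : ℝ) : EReal) := by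
    intro t ω hω
    rw [hXE.coe_toReal t ω hω t le_rfl, hXE.coe_toReal t ω hω 0 (zero_le), ← EReal.coe_sub,
      ← EReal.coe_pow]
  set a : ℕ → ℝ≥0 → Ω → ℝ := fun n t ω => (simpleQV X (τ n) t ω).toReal with ha
  set q : ℝ≥0 → Ω → ℝ := fun t ω => (Q t ω).toReal with hq
  have haq : ∀ t ω, (t, ω) ∈ E → ∀ η > 0, ∀ᶠ n in atTop, ∀ s ≤ t,
      Q s ω = (q s ω : EReal) ∧ |a n s ω - q s ω| < η := by
    intro t ω hω η hη
    filter_upwards [eventually_of_tendsto_uniformDist hω.2 hη] with n hn s hs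
    exact (hn s hs).2
  have hQq : ∀ t ω, (t, ω) ∈ E → Q t ω = (q t ω : EReal) := fun t ω hω =>
    ((haq t ω hω 1 one_pos).exists.choose_spec t le_rfl).1
  have haeq : ∀ n (t : ℝ≥0) ω k, (t, ω) ∈ E → (t : WithTop ℝ≥0) ≤ τ n k ω →
      a n t ω = partialQV x (τ n) k t ω := fun n t ω k hω hk => by
    simp only [ha]
    rw [hXE.toReal_simpleQV_coverTime hω (hε n) hk, EReal.toReal_coe]
  have ha0 : ∀ n t ω, 0 ≤ a n t ω := fun n t ω => by
    simp only [ha, simpleQV, EReal.toReal_coe_ennreal]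
    exact ENNReal.toReal_nonneg
  have har : ∀ n, 𝔐.IsRegular E (a n) := fun n =>
    hXE.isRegular_simpleQV hA hE (isStoppingTime_coverTime hA hE hxE) (hfin n)
  have hqr : 𝔐.IsRegular E q := by
    refine ⟨hQ.isAdapted.measurable_toReal, fun t ω hω => ?_⟩
    refine continuousOn_of_eventually (y := fun n s => a n s ω) (fun η hη => ?_)
      fun n => (har n).continuousOn t ω hω
    filter_upwards [haq t ω hω η hη] with n hn s hs
    exact (hn s hs).2
  -- Taking `c = 2` turns `[X]^τ` into the square, and `c = -2` turns the square into `[X]^τ`.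
  have hstep : ∀ n c (t : ℝ≥0) ω k, (t, ω) ∈ E → (t : WithTop ℝ≥0) ≤ τ n k ω →
      stepIntegral (τ n) (displacement c (ε n) x (τ n)) k (fun _ => ⊤) x t ω =
        c / 2 * ((x t ω - x 0 ω) ^ 2 - a n t ω) := by
    intro n c t ω k hω hk
    rw [stepIntegral_displacement (hε n) c (hxE.continuousOn t ω hω) k, haeq n t ω k hω hk,
      clock_of_le hk]
  have hdata := fun n c => stepData_displacement hA hE hxE (hε n) c
  refine le_antisymm (upperExp_le_upperExp fun Y hY hle δ hδ => ?_)
    (upperExp_le_upperExp fun Y hY hle δ hδ => ?_)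
  all_goals
    obtain ⟨U, hU, hU0, hUE⟩ := hE.exists_small (δ := δ / 4) (by positivity)
    have hη : 0 < δ / 4 := by positivity
  -- `Y` dominates `[X]`, not `[X]^{τ^n}`; it is used, with `δ / 4` in cash, only until the two
  -- differ by `δ / 4`.
  · have hT : ∀ n, IsStoppingTime 𝔐.filt (hit (δ / 4) fun t ω => a n t ω - q t ω) := fun n =>
      ((har n).sub hqr).isStoppingTime_hit hA hE _
    have hzero : ∀ n ω, a n 0 ω - q 0 ω = 0 := by
      have h1 : ∀ n ω, a n 0 ω = 0 := fun n ω => by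
        simp only [ha]
        rw [hXE.simpleQV_zero (hE.zero_mem ω), EReal.toReal_zero]
      intro n ω
      have h2 : q 0 ω = 0 := by
        by_contra hne
        obtain ⟨k, hk⟩ := (haq 0 ω (hE.zero_mem ω) _ (abs_pos.2 hne)).exists
        have := (hk 0 le_rfl).2
        rw [h1, zero_sub, abs_neg] at this
        exact this.false
      rw [h1, h2, sub_zero]
    have hY1 := hY.add_process (IsNonnegSupermartingale.const hd 𝔐 hη.le)
    choose Y' hY' hY'0 hY'le using fun n => hX.exists_dominating hd hA hE (hdata n 2) (hfin n)
      (p := a n) (p' := fun t ω => (x t ω - x 0 ω) ^ 2) (fun t ω => sq_nonneg _)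
      (fun t ω k hω hk => by rw [hstep n 2 t ω k hω hk]; ring) (hT n) hY1
      (fun t ω hω htT => by
        have h1 := (abs_le.1 (abs_le_of_le_hit hη (((har n).sub hqr).continuousOn t ω hω)
          (hzero n ω) htT)).2
        calc (a n t ω : EReal) ≤ ((q t ω + δ / 4 : ℝ) : EReal) :=
              EReal.coe_le_coe_iff.2 (by linarith)
          _ = Q t ω + ((δ / 4 : ℝ) : EReal) := by rw [hQq t ω hω, EReal.coe_add]
          _ ≤ _ := add_le_add (hle t ω) le_rfl) hη
    refine ⟨_, (IsNonnegSupermartingale.liminf _ hY').add_process hU, fun ω => ?_, fun t ω => ?_⟩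
    · have h1 : liminf (fun n => Y' n 0 ω) atTop ≤ Y 0 ω + ((δ / 4 : ℝ) : EReal) +
          ((δ / 4 : ℝ) : EReal) :=
        (liminf_le_liminf (Eventually.of_forall fun n => hY'0 n ω)).trans (liminf_const _).le
      refine (add_le_add h1 (hU0 ω).le).trans ?_
      rw [add_assoc, add_assoc, ← EReal.coe_add, ← EReal.coe_add]
      exact add_le_add le_rfl (EReal.coe_le_coe_iff.2 (by linarith))
    · by_cases hω : (t, ω) ∈ E
      · rw [hsq t ω hω]
        refine le_trans ?_ (le_add_of_nonneg_right (hU.nonneg t ω))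
        refine le_liminf_of_le (by isBoundedDefault) ?_
        filter_upwards [haq t ω hω _ hη] with n hn
        exact hY'le n t ω hω (lt_hit fun s hs => (hn s hs).2).le
      · rw [hUE t ω hω, EReal.add_top_of_ne_bot]
        · exact le_top
        · exact (IsNonnegSupermartingale.liminf _ hY').ne_bot t ω
  -- Here `Y` dominates the square at all times, so no stopping is needed; `[X]^{τ^n}` is compared
  -- with `[X]` only after the `liminf`.
  · choose Y' hY' hY'0 hY'le using fun n => hX.exists_dominating hd hA hE (hdata n (-2)) (hfin n)
      (p := fun t ω => (x t ω - x 0 ω) ^ 2) (p' := a n) (ha0 n)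
      (fun t ω k hω hk => by rw [hstep n (-2) t ω k hω hk]; ring) (isStoppingTime_top 𝔐) hY
      (fun t ω hω _ => by rw [← hsq t ω hω]; exact hle t ω) hη
    refine ⟨_, (IsNonnegSupermartingale.liminf _ hY').add_process
      ((IsNonnegSupermartingale.const hd 𝔐 hη.le).add_process hU), fun ω => ?_, fun t ω => ?_⟩
    · have h1 : liminf (fun n => Y' n 0 ω) atTop ≤ Y 0 ω + ((δ / 4 : ℝ) : EReal) :=
        (liminf_le_liminf (Eventually.of_forall fun n => hY'0 n ω)).trans (liminf_const _).le
      rw [hU0]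
      refine (add_le_add h1 le_rfl).trans ?_
      rw [add_assoc, ← EReal.coe_add, ← EReal.coe_add]
      exact add_le_add le_rfl (EReal.coe_le_coe_iff.2 (by linarith))
    · by_cases hω : (t, ω) ∈ E
      · have h1 : ((q t ω - δ / 4 : ℝ) : EReal) ≤ liminf (fun n => Y' n t ω) atTop := by
          refine le_liminf_of_le (by isBoundedDefault) ?_
          filter_upwards [haq t ω hω _ hη] with n hn
          refine le_trans (EReal.coe_le_coe_iff.2 ?_) (hY'le n t ω hω le_top)
          linarith [(abs_lt.1 (hn t le_rfl).2).1]
        calc Q t ω = ((q t ω - δ / 4 : ℝ) : EReal) + ((δ / 4 : ℝ) : EReal) := by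
              rw [hQq t ω hω, ← EReal.coe_add, sub_add_cancel]
          _ ≤ _ := add_le_add h1 (le_add_of_nonneg_right (hU.nonneg t ω))
      · rw [hUE t ω hω, EReal.coe_add_top, EReal.add_top_of_ne_bot]
        · exact le_top
        · exact (IsNonnegSupermartingale.liminf _ hY').ne_bot t ω
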